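/- Let $q\in\mathbb{C}$ with $0<|q|<1$, and let $\mathfrak{A}_q=\mathbb{C}\langle x,y\rangle/(xy-q^{-1}yx)$ be the quantum plane. A subset of $\mathbb{C}$ is called $q$-open if it is empty, or if it is open in the standard topology, contains $0$, and contains $q^nz$ $(n\ge 0)$ whenever it contains $z$; these sets form the $\mathfrak{q}$-topology. The disk topology $\mathfrak{d}$ of $\mathbb{C}$ is the one given by the open disks $B(0,r)$ (its open sets are $\varnothing$, $\mathbb{C}$ and the disks $B(0,r)$). Let $\mathbb{C}_{xy}=\mathbb{C}_x\cup\mathbb{C}_y\subseteq\mathbb{C}^2$, where $\mathbb{C}_x=\mathbb{C}\times\{0\}$ and $\mathbb{C}_y=\{0\}\times\mathbb{C}$, carry the final topology (the $(\mathfrak{q},\mathfrak{d})$-topology) for the embeddings of $(\mathbb{C}_x,\mathfrak{q})$ and $(\mathbb{C}_y,\mathfrak{d})$. For a $(\mathfrak{q},\mathfrak{d})$-open set $U\subseteq\mathbb{C}_{xy}$ write $U=U_x\cup U_y$ with $U_x=U\cap\mathbb{C}_x$ and $U_y=U\cap\mathbb{C}_y$, regarded as subsets of $\mathbb{C}$,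 and let $r_y\in[0,\infty]$ be the radius of the disk $U_y$. Let $\mathcal{O}_q(U)$ be the algebra of all formal series $f=\sum_{n\ge 0}f_n(x)y^n$ with $f_n$ holomorphic on $U_x$ and $$p_{K,\rho}(f)=\sum_{n}\Big(\sup_{K}|f_n|\Big)\rho^n<\infty\qquad\text{for all compact }K\subseteq U_x,\ 0<\rho<r_y,$$ with the topology defined by the seminorms $p_{K,\rho}$ and the multiplication $f\cdot g=\sum_n\big(\sum_{i+j=n}f_i(x)g_j(q^ix)\big)y^n$; for $U=\varnothing$, $\mathcal{O}_q(\varnothing)=\{0\}$. There is a canonical homomorphism $\mathfrak{A}_q\to\mathcal{O}_q(U)$, $x\mapsto x$, $y\mapsto y$. Theorem. Let $T,S$ be elements of a complex unital Banach algebra $\mathcal{B}$ with $TS=q^{-1}ST$, and let $U\subseteq\mathbb{C}_{xy}$ be a $(\mathfrak{q},\mathfrak{d})$-open set. The representation $\mathfrak{A}_q\to\mathcal{B}$, $x\mapsto T$, $y\mapsto S$, extends to a continuous unital algebra homomorphism $\mathcal{O}_q(U)\to\mathcal{B}$ (that is, it is the composition of such a homomorphism with $\mathfrak{A}_q\to\mathcal{O}_q(U)$)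 if and only if $\sigma(T)\subseteq U_x$ and $\sigma(S)\subseteq U_y$, where $\sigma$ denotes the spectrum in $\mathcal{B}$. Moreover, if these inclusions hold, then there is exactly one continuous unital algebra homomorphism $\mathcal{O}(U_x)\to\mathcal{B}$ sending the coordinate function to $T$ (the holomorphic functional calculus $h\mapsto h(T)$; here $\mathcal{O}(U_x)$ carries the topology of uniform convergence on compact sets), and every extension as above is given by $$\sum_n f_n(x)y^n\longmapsto\sum_n f_n(T)S^n,$$ the series on the right being absolutely convergent in $\mathcal{B}$. -/

import Mathlib

open TopologicalSpace Topology

noncomputable section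

namespace QPlane

/-! ### The quantum plane and its representations -/

/-- The defining relation `x y = q⁻¹ y x` on the free algebra in `x = ι 0` and `y = ι 1`. -/
inductive Rel (q : ℂ) : FreeAlgebra ℂ (Fin 2) → FreeAlgebra ℂ (Fin 2) → Prop
  | xy : Rel q (FreeAlgebra.ι ℂ 0 * FreeAlgebra.ι ℂ 1)
      (q⁻¹ • (FreeAlgebra.ι ℂ 1 * FreeAlgebra.ι ℂ 0))

/-- The quantum plane `ℂ⟨x, y⟩ / (x y - q⁻¹ y x)`. -/
abbrev QuantumPlane (q : ℂ) : Type := RingQuot (Rel q)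

/-- The representation `x ↦ T`, `y ↦ S` of the quantum plane defined by a pair with
`T S = q⁻¹ S T`. -/
def representation {q : ℂ} {B : Type*} [Ring B] [Algebra ℂ B] (T S : B)
    (h : T * S = q⁻¹ • (S * T)) : QuantumPlane q →ₐ[ℂ] B :=
  RingQuot.liftAlgHom ℂ ⟨FreeAlgebra.lift ℂ ![T, S], by
    intro a b hab
    cases hab
    simpa using h⟩

/-! ### The `q`-topology, the disk topology and the `(q, d)`-topology -/

/-- `q`-spiraling sets. -/
def IsSpiraling (q : ℂ) (V : Set ℂ) : Prop :=
  0 ∈ V ∧ ∀ z ∈ V, ∀ n : ℕ, q ^ n * z ∈ V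

/-- The `q`-topology of `ℂ`: the open sets are the empty set and the `q`-spiraling sets that are
open in the standard topology. -/
@[reducible] def qTopology (q : ℂ) : TopologicalSpace ℂ where
  IsOpen V := V = ∅ ∨ (IsOpen V ∧ IsSpiraling q V)
  isOpen_univ := Or.inr ⟨_root_.isOpen_univ, Set.mem_univ _, fun _ _ _ => Set.mem_univ _⟩
  isOpen_inter := by
    rintro V W (rfl | ⟨hV, hV0, hVq⟩) (rfl | ⟨hW, hW0, hWq⟩)
    · simp
    · simp
    · simp
    · exact Or.inr ⟨hV.inter hW, ⟨hV0, hW0⟩, fun z hz n => ⟨hVq z hz.1 n, hWq z hz.2 n⟩⟩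
  isOpen_sUnion := by
    intro s hs
    rcases Set.eq_empty_or_nonempty (⋃₀ s) with h | ⟨z, V, hV, hz⟩
    · exact Or.inl h
    · refine Or.inr ⟨_root_.isOpen_sUnion fun W hW => ?_, ?_, ?_⟩
      · rcases hs W hW with rfl | h
        · exact isOpen_empty
        · exact h.1
      · rcases hs V hV with rfl | h
        · exact absurd hz (Set.notMem_empty _)
        · exact ⟨V, hV, h.2.1⟩
      · rintro w ⟨W, hW, hw⟩ n
        rcases hs W hW with rfl | h
        · exact absurd hw (Set.notMem_empty _)
        · exact ⟨W, hW, h.2.2 w hw n⟩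

/-- The disk topology of `ℂ`, given by the open disks centered at the origin. -/
@[reducible] def diskTopology : TopologicalSpace ℂ :=
  generateFrom {V | ∃ r : ℝ, 0 < r ∧ V = Metric.ball (0 : ℂ) r}

/-- `ℂ_x = ℂ × {0}`. -/
def Cx : Set (ℂ × ℂ) := Set.univ ×ˢ {0}

/-- `ℂ_y = {0} × ℂ`. -/
def Cy : Set (ℂ × ℂ) := {0} ×ˢ Set.univ

/-- `ℂ_xy = ℂ_x ∪ ℂ_y`. -/
def Cxy : Set (ℂ × ℂ) := Cx ∪ Cy

/-- The embedding of `ℂ` as `ℂ_x` into `ℂ_xy`. -/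
def inclX (z : ℂ) : Cxy := ⟨(z, 0), Or.inl ⟨Set.mem_univ _, rfl⟩⟩

/-- The embedding of `ℂ` as `ℂ_y` into `ℂ_xy`. -/
def inclY (w : ℂ) : Cxy := ⟨(0, w), Or.inr ⟨rfl, Set.mem_univ _⟩⟩

/-- The `(q, d)`-topology of `ℂ_xy`: the final topology for the embeddings of `ℂ_x` with the
`q`-topology and of `ℂ_y` with the disk topology. (In Mathlib's order of topologies `⊔` is the
topology whose open sets are those open for both.) -/
@[reducible] def qdTopology (q : ℂ) : TopologicalSpace Cxy :=
  coinduced inclX (qTopology q) ⊔ coinduced inclY diskTopology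

/-- The `(q, d)`-open subsets of `ℂ_xy`. -/
structure QDOpens (q : ℂ) where
  /-- The underlying subset. -/
  carrier : Set Cxy
  isOpen' : IsOpen[qdTopology q] carrier

/-- The part `U_x` of `U = U_x ∪ U_y`. -/
def partX {q : ℂ} (U : QDOpens q) : Set ℂ := inclX ⁻¹' U.carrier

/-- The part `U_y` of `U = U_x ∪ U_y`. -/
def partY {q : ℂ} (U : QDOpens q) : Set ℂ := inclY ⁻¹' U.carrier

theorem partX_isOpen_q {q : ℂ} (U : QDOpens q) : IsOpen[qTopology q] (partX U) :=
  (show IsOpen[coinduced inclX (qTopology q)] U.carrier from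
    (le_sup_left : coinduced inclX (qTopology q) ≤ qdTopology q) _ U.isOpen')

theorem isSpiraling_partX {q : ℂ} (U : QDOpens q) (h : (partX U).Nonempty) :
    IsSpiraling q (partX U) := by
  rcases partX_isOpen_q U with h' | h'
  · simp [h'] at h
  · exact h'.2

theorem pow_mul_mem_partX {q : ℂ} (U : QDOpens q) (n : ℕ) {z : ℂ} (hz : z ∈ partX U) :
    q ^ n * z ∈ partX U :=
  (isSpiraling_partX U ⟨z, hz⟩).2 z hz n

/-! ### Holomorphic functions -/

/-- The algebra `𝒪(V)` of holomorphic functions on a (standard) open set `V`. As a subspace of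
`C(V, ℂ)` it carries the topology of uniform convergence on compact subsets of `V`. -/
def Hol (V : Set ℂ) : Subalgebra ℂ C(V, ℂ) where
  carrier := {f | ∃ F : ℂ → ℂ, DifferentiableOn ℂ F V ∧ ∀ z : V, f z = F z}
  mul_mem' := by
    rintro f g ⟨F, hF, hf⟩ ⟨G, hG, hg⟩
    exact ⟨fun z => F z * G z, hF.mul hG, fun z => by simp [hf z, hg z]⟩
  add_mem' := by
    rintro f g ⟨F, hF, hf⟩ ⟨G, hG, hg⟩
    exact ⟨fun z => F z + G z, hF.add hG, fun z => by simp [hf z, hg z]⟩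
  algebraMap_mem' c := ⟨fun _ => c, differentiableOn_const c, fun _ => rfl⟩

/-- The coordinate function `z` in `𝒪(V)`. -/
def coord (V : Set ℂ) : Hol V :=
  ⟨⟨fun z => (z : ℂ), continuous_subtype_val⟩, fun z => z, differentiableOn_id, fun _ => rfl⟩

/-- The sup-norm `‖f‖_K` over a compact subset `K` of `V`. -/
def normOn {V : Set ℂ} (K : Compacts V) (f : Hol V) : ℝ := ‖f.1.restrict (K : Set V)‖

/-- The homomorphism `g(x) ↦ g(qⁱ x)` of `𝒪(U_x)`. -/
def twist {q : ℂ} (U : QDOpens q) (i : ℕ) : Hol (partX U) →ₐ[ℂ] Hol (partX U) :=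
  ((ContinuousMap.compRightAlgHom ℂ ℂ
      (⟨fun z => ⟨q ^ i * z, pow_mul_mem_partX U i z.2⟩, by fun_prop⟩ :
        C(partX U, partX U))).comp (Hol (partX U)).val).codRestrict (Hol (partX U)) (by
    rintro ⟨f, F, hF, hf⟩
    refine ⟨fun z => F (q ^ i * z), ?_, fun z => hf _⟩
    exact hF.comp (by fun_prop) fun z hz => pow_mul_mem_partX U i hz)

theorem twist_apply {q : ℂ} (U : QDOpens q) (i : ℕ) (g : Hol (partX U)) (z : partX U) :
    (twist U i g).1 z = g.1 ⟨q ^ i * z, pow_mul_mem_partX U i z.2⟩ := rfl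

theorem twist_zero {q : ℂ} (U : QDOpens q) (g : Hol (partX U)) : twist U 0 g = g := by
  ext z
  simp [twist_apply]

theorem twist_twist {q : ℂ} (U : QDOpens q) (i j : ℕ) (g : Hol (partX U)) :
    twist U i (twist U j g) = twist U (i + j) g := by
  ext z
  simp only [twist_apply]
  congr 2
  ring

/-! ### Formal power series with the formal `q`-multiplication -/

/-- The space `𝒪(U_x)[[y]]`; the sequence `f` stands for `∑ fₙ(x) yⁿ`. -/
def FormalSeries {q : ℂ} (U : QDOpens q) : Type := ℕ → Hol (partX U)

namespace FormalSeries

variable {q : ℂ} {U : QDOpens q}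

/-- The coefficient `fₙ`. -/
def coeff (n : ℕ) (f : FormalSeries U) : Hol (partX U) := f n

/-- The series with given coefficients. -/
def mk (a : ℕ → Hol (partX U)) : FormalSeries U := a

@[simp] theorem coeff_mk (n : ℕ) (a : ℕ → Hol (partX U)) : coeff n (mk a) = a n := rfl

@[ext] theorem ext {f g : FormalSeries U} (h : ∀ n, coeff n f = coeff n g) : f = g := funext h

instance : AddCommGroup (FormalSeries U) := inferInstanceAs (AddCommGroup (ℕ → Hol (partX U)))

instance : Module ℂ (FormalSeries U) := inferInstanceAs (Module ℂ (ℕ → Hol (partX U)))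

@[simp] theorem coeff_zero (n : ℕ) : coeff n (0 : FormalSeries U) = 0 := rfl

@[simp] theorem coeff_add (n : ℕ) (f g : FormalSeries U) :
    coeff n (f + g) = coeff n f + coeff n g := rfl

@[simp] theorem coeff_smul (n : ℕ) (c : ℂ) (f : FormalSeries U) :
    coeff n (c • f) = c • coeff n f := rfl

/-- The formal `q`-multiplication `f · g = ∑ₙ (∑_{i+j=n} fᵢ(x) gⱼ(qⁱ x)) yⁿ`. -/
instance : Mul (FormalSeries U) where
  mul f g := mk fun n => ∑ p ∈ Finset.HasAntidiagonal.antidiagonal n, coeff p.1 f * twist U p.1 (coeff p.2 g)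

instance : One (FormalSeries U) where
  one := mk fun n => if n = 0 then 1 else 0

theorem coeff_mul (n : ℕ) (f g : FormalSeries U) :
    coeff n (f * g) =
      ∑ p ∈ Finset.HasAntidiagonal.antidiagonal n, coeff p.1 f * twist U p.1 (coeff p.2 g) := rfl

theorem coeff_one (n : ℕ) : coeff n (1 : FormalSeries U) = if n = 0 then 1 else 0 := rfl

protected theorem one_mul (f : FormalSeries U) : 1 * f = f := by
  ext1 n
  rw [coeff_mul, Finset.sum_eq_single (0, n)]
  · simp [coeff_one, twist_zero]
  · rintro ⟨i, j⟩ h hne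
    have : i ≠ 0 := by
      rintro rfl
      simp at h
      exact hne (by simp [h])
    simp [coeff_one, this]
  · simp

protected theorem mul_one (f : FormalSeries U) : f * 1 = f := by
  ext1 n
  rw [coeff_mul, Finset.sum_eq_single (n, 0)]
  · simp [coeff_one]
  · rintro ⟨i, j⟩ h hne
    have : j ≠ 0 := by
      rintro rfl
      simp at h
      exact hne (by simp [h])
    simp [coeff_one, this]
  · simp

protected theorem mul_assoc (f g h : FormalSeries U) : f * g * h = f * (g * h) := by
  ext1 n
  simp only [coeff_mul, Finset.sum_mul, Finset.mul_sum, map_sum, map_mul, twist_twist,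
    Finset.sum_sigma']
  apply Finset.sum_nbij' (fun ⟨⟨_i, j⟩, ⟨k, l⟩⟩ ↦ ⟨(k, l + j), (l, j)⟩)
    (fun ⟨⟨i, _j⟩, ⟨k, l⟩⟩ ↦ ⟨(i + k, l), (i, k)⟩)
  · rintro ⟨⟨i, j⟩, ⟨k, l⟩⟩ hp
    simp at hp ⊢
    omega
  · rintro ⟨⟨i, j⟩, ⟨k, l⟩⟩ hp
    simp at hp ⊢
    omega
  · rintro ⟨⟨i, j⟩, ⟨k, l⟩⟩ hp
    simp at hp ⊢
    exact hp.2
  · rintro ⟨⟨i, j⟩, ⟨k, l⟩⟩ hp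
    simp at hp ⊢
    exact hp.2
  · rintro ⟨⟨i, j⟩, ⟨k, l⟩⟩ hp
    simp at hp
    simp [hp.2, mul_assoc]

instance : Ring (FormalSeries U) :=
  { (inferInstance : AddCommGroup (FormalSeries U)) with
    mul := (· * ·)
    one := 1
    one_mul := FormalSeries.one_mul
    mul_one := FormalSeries.mul_one
    mul_assoc := FormalSeries.mul_assoc
    zero_mul := fun f => by ext1 n; simp [coeff_mul]
    mul_zero := fun f => by ext1 n; simp [coeff_mul]
    left_distrib := fun f g h => by
      ext1 n; simp [coeff_mul, mul_add, Finset.sum_add_distrib]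
    right_distrib := fun f g h => by
      ext1 n; simp [coeff_mul, add_mul, Finset.sum_add_distrib] }

instance : Algebra ℂ (FormalSeries U) :=
  Algebra.ofModule
    (fun c f g => by ext1 n; simp [coeff_mul, Finset.smul_sum])
    (fun c f g => by ext1 n; simp [coeff_mul, Finset.smul_sum])

end FormalSeries

open FormalSeries

/-! ### The algebra `𝒪_q(U)` -/

section Norms

variable {V : Set ℂ} (K : Compacts V)

theorem normOn_nonneg (f : Hol V) : 0 ≤ normOn K f := norm_nonneg _

theorem normOn_zero : normOn K (0 : Hol V) = 0 := by
  unfold normOn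
  exact norm_zero (E := C((K : Set V), ℂ))

theorem normOn_one_le : normOn K (1 : Hol V) ≤ 1 :=
  (ContinuousMap.norm_le _ zero_le_one).2 fun _ => norm_one.le

theorem normOn_add_le (f g : Hol V) : normOn K (f + g) ≤ normOn K f + normOn K g :=
  norm_add_le (f.1.restrict (K : Set V)) (g.1.restrict (K : Set V))

theorem normOn_mul_le (f g : Hol V) : normOn K (f * g) ≤ normOn K f * normOn K g :=
  norm_mul_le (f.1.restrict (K : Set V)) (g.1.restrict (K : Set V))

theorem normOn_smul (c : ℂ) (f : Hol V) : normOn K (c • f) = ‖c‖ * normOn K f :=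
  norm_smul c (f.1.restrict (K : Set V))

theorem normOn_sum_le {ι : Type*} (s : Finset ι) (f : ι → Hol V) :
    normOn K (∑ i ∈ s, f i) ≤ ∑ i ∈ s, normOn K (f i) := by
  classical
  induction s using Finset.induction_on with
  | empty => simp [normOn_zero]
  | insert a s ha ih =>
    rw [Finset.sum_insert ha, Finset.sum_insert ha]
    exact (normOn_add_le K _ _).trans (by gcongr)

theorem norm_apply_le_normOn (f : Hol V) {z : V} (hz : z ∈ K) : ‖f.1 z‖ ≤ normOn K f :=
  ContinuousMap.norm_coe_le_norm (f.1.restrict (K : Set V)) ⟨z, hz⟩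

theorem normOn_le {f : Hol V} {C : ℝ} (hC : 0 ≤ C) (h : ∀ z ∈ K, ‖f.1 z‖ ≤ C) :
    normOn K f ≤ C :=
  (ContinuousMap.norm_le _ hC).2 fun z => h z.1 z.2

end Norms

/-- If `|q| < 1`, every compact subset of `U_x` lies in a compact subset of `U_x` which is stable
under the multiplications by `qⁱ`. -/
theorem exists_compacts_hull {q : ℂ} (hq : ‖q‖ < 1) (U : QDOpens q) (K : Compacts (partX U)) :
    ∃ L : Compacts (partX U), ∀ (i : ℕ) (z : partX U), z ∈ K →
      (⟨q ^ i * z, pow_mul_mem_partX U i z.2⟩ : partX U) ∈ L := by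
  have hA : IsCompact (insert (0 : ℂ) (Set.range fun n : ℕ => q ^ n)) :=
    (tendsto_pow_atTop_nhds_zero_of_norm_lt_one hq).isCompact_insert_range
  have hL : IsCompact ((fun p : ℂ × ℂ => p.1 * p.2) ''
      (insert (0 : ℂ) (Set.range fun n : ℕ => q ^ n) ×ˢ (Subtype.val '' (K : Set (partX U))))) :=
    (hA.prod (K.isCompact.image continuous_subtype_val)).image (by fun_prop)
  have hsub : ((fun p : ℂ × ℂ => p.1 * p.2) ''
      (insert (0 : ℂ) (Set.range fun n : ℕ => q ^ n) ×ˢ (Subtype.val '' (K : Set (partX U)))))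
      ⊆ partX U := by
    rintro _ ⟨⟨a, b⟩, ⟨ha, z, hz, rfl⟩, rfl⟩
    rcases ha with rfl | ⟨n, rfl⟩
    · simpa using (isSpiraling_partX U ⟨z, z.2⟩).1
    · exact pow_mul_mem_partX U n z.2
  refine ⟨⟨Subtype.val ⁻¹' _, Topology.IsInducing.subtypeVal.isCompact_preimage_iff
    (by simpa using hsub) |>.2 hL⟩, fun i z hz => ?_⟩
  exact ⟨(q ^ i, (z : ℂ)), ⟨Or.inr ⟨i, rfl⟩, z, hz, rfl⟩, rfl⟩

theorem normOn_coeff_mul_le {q : ℂ} {U : QDOpens q} {K L : Compacts (partX U)}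
    (hL : ∀ (i : ℕ) (z : partX U), z ∈ K →
      (⟨q ^ i * z, pow_mul_mem_partX U i z.2⟩ : partX U) ∈ L)
    (f g : FormalSeries U) (n : ℕ) :
    normOn K (coeff n (f * g)) ≤
      ∑ p ∈ Finset.HasAntidiagonal.antidiagonal n,
        normOn L (coeff p.1 f) * normOn L (coeff p.2 g) := by
  have h0 : ∀ h : Hol (partX U), normOn K h ≤ normOn L h := fun h =>
    normOn_le K (normOn_nonneg L h) fun z hz => by
      have := hL 0 z hz
      simp only [pow_zero, one_mul] at this
      exact norm_apply_le_normOn L h this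
  have h1 : ∀ (i : ℕ) (h : Hol (partX U)), normOn K (twist U i h) ≤ normOn L h := fun i h =>
    normOn_le K (normOn_nonneg L h) fun z hz => by
      rw [twist_apply]
      exact norm_apply_le_normOn L h (hL i z hz)
  rw [coeff_mul]
  refine (normOn_sum_le K _ _).trans (Finset.sum_le_sum fun p _ => ?_)
  exact (normOn_mul_le K _ _).trans
    (mul_le_mul (h0 _) (h1 _ _) (normOn_nonneg K _) (normOn_nonneg L _))

/-- The condition `p_{K,ρ}(f) = ∑ₙ ‖fₙ‖_K ρⁿ < ∞` for every compact `K ⊆ U_x` and every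
`0 < ρ < r_y`, where `r_y ≤ ∞` is the radius of the disk `U_y` (so that `ρ < r_y` means
`ρ ∈ U_y`). -/
def HasFiniteSeminorms {q : ℂ} {U : QDOpens q} (f : FormalSeries U) : Prop :=
  ∀ (K : Compacts (partX U)) (ρ : ℝ), 0 < ρ → (ρ : ℂ) ∈ partY U →
    Summable fun n => normOn K (coeff n f) * ρ ^ n

theorem HasFiniteSeminorms.add {q : ℂ} {U : QDOpens q} {f g : FormalSeries U}
    (hf : HasFiniteSeminorms f) (hg : HasFiniteSeminorms g) : HasFiniteSeminorms (f + g) := by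
  intro K ρ hρ hρU
  refine Summable.of_nonneg_of_le (fun n => ?_) (fun n => ?_)
    ((hf K ρ hρ hρU).add (hg K ρ hρ hρU))
  · exact mul_nonneg (normOn_nonneg K _) (pow_nonneg hρ.le n)
  · rw [← add_mul, coeff_add]
    exact mul_le_mul_of_nonneg_right (normOn_add_le K _ _) (pow_nonneg hρ.le n)

theorem summable_antidiagonal {a b : ℕ → ℝ} (ha : Summable a) (hb : Summable b)
    (ha0 : ∀ n, 0 ≤ a n) (hb0 : ∀ n, 0 ≤ b n) :
    Summable fun n => ∑ p ∈ Finset.HasAntidiagonal.antidiagonal n, a p.1 * b p.2 :=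
  summable_sum_mul_antidiagonal_of_summable_mul (ha.mul_of_nonneg hb ha0 hb0)

theorem HasFiniteSeminorms.mul {q : ℂ} (hq : ‖q‖ < 1) {U : QDOpens q} {f g : FormalSeries U}
    (hf : HasFiniteSeminorms f) (hg : HasFiniteSeminorms g) : HasFiniteSeminorms (f * g) := by
  intro K ρ hρ hρU
  obtain ⟨L, hL⟩ := exists_compacts_hull hq U K
  have hfg := summable_antidiagonal (hf L ρ hρ hρU) (hg L ρ hρ hρU)
    (fun n => mul_nonneg (normOn_nonneg L _) (pow_nonneg hρ.le n))
    (fun n => mul_nonneg (normOn_nonneg L _) (pow_nonneg hρ.le n))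
  refine Summable.of_nonneg_of_le (fun n => ?_) (fun n => ?_) hfg
  · exact mul_nonneg (normOn_nonneg K _) (pow_nonneg hρ.le n)
  · refine (mul_le_mul_of_nonneg_right (normOn_coeff_mul_le hL f g n)
      (pow_nonneg hρ.le n)).trans_eq ?_
    rw [Finset.sum_mul]
    refine Finset.sum_congr rfl fun p hp => ?_
    rw [← Finset.HasAntidiagonal.mem_antidiagonal.1 hp, pow_add]
    ring

theorem HasFiniteSeminorms.of_coeff_eq_zero {q : ℂ} {U : QDOpens q} {f : FormalSeries U} (k : ℕ)
    (h : ∀ n, n ≠ k → coeff n f = 0) : HasFiniteSeminorms f := fun K ρ _ _ =>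
  summable_of_ne_finset_zero (s := {k}) fun n hn => by
    rw [h n (by simpa using hn), normOn_zero, zero_mul]

/-- The algebra `𝒪_q(U)` of all series `f = ∑ fₙ(x) yⁿ` with `fₙ ∈ 𝒪(U_x)` such that all
`p_{K,ρ}(f)` are finite. The multiplication is the formal `q`-multiplication. -/
def Oq {q : ℂ} (hq : ‖q‖ < 1) (U : QDOpens q) : Subalgebra ℂ (FormalSeries U) where
  carrier := {f | HasFiniteSeminorms f}
  add_mem' := HasFiniteSeminorms.add
  mul_mem' := HasFiniteSeminorms.mul hq
  algebraMap_mem' c := HasFiniteSeminorms.of_coeff_eq_zero 0 fun n hn => by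
    rw [Algebra.algebraMap_eq_smul_one, coeff_smul, coeff_one, if_neg hn, smul_zero]

/-- The seminorm `p_{K,ρ}(f) = ∑ₙ ‖fₙ‖_K ρⁿ` of `𝒪_q(U)`. -/
def seminorm {q : ℂ} (hq : ‖q‖ < 1) (U : QDOpens q) (K : Compacts (partX U))
    (ρ : {ρ : ℝ // 0 < ρ ∧ (ρ : ℂ) ∈ partY U}) : Seminorm ℂ (Oq hq U) :=
  Seminorm.of (fun f => ∑' n, normOn K (coeff n f.1) * (ρ : ℝ) ^ n)
    (fun f g => by
      have hρ := ρ.2.1.le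
      have hf := f.2 K ρ ρ.2.1 ρ.2.2
      have hg := g.2 K ρ ρ.2.1 ρ.2.2
      rw [← hf.tsum_add hg]
      refine ((f + g).2 K ρ ρ.2.1 ρ.2.2).tsum_le_tsum (fun n => ?_) (hf.add hg)
      rw [← add_mul]
      exact mul_le_mul_of_nonneg_right (normOn_add_le K _ _) (by positivity))
    (fun c f => by
      rw [← tsum_mul_left]
      refine tsum_congr fun n => ?_
      rw [← mul_assoc, ← normOn_smul]
      rfl)

/-- The topology of `𝒪_q(U)` is defined by the seminorms `p_{K,ρ}`. -/
instance {q : ℂ} (hq : ‖q‖ < 1) (U : QDOpens q) : TopologicalSpace (Oq hq U) :=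
  ⨅ i : Compacts (partX U) × {ρ : ℝ // 0 < ρ ∧ (ρ : ℂ) ∈ partY U},
    (seminorm hq U i.1 i.2).toSeminormedAddCommGroup.toUniformSpace.toTopologicalSpace

/-- The element `x` of `𝒪_q(U)`. -/
def Oq.x {q : ℂ} (hq : ‖q‖ < 1) (U : QDOpens q) : Oq hq U :=
  ⟨FormalSeries.mk fun n => if n = 0 then coord (partX U) else 0,
    HasFiniteSeminorms.of_coeff_eq_zero 0 fun n hn => by rw [coeff_mk, if_neg hn]⟩

/-- The element `y` of `𝒪_q(U)`. -/
def Oq.y {q : ℂ} (hq : ‖q‖ < 1) (U : QDOpens q) : Oq hq U :=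
  ⟨FormalSeries.mk fun n => if n = 1 then 1 else 0,
    HasFiniteSeminorms.of_coeff_eq_zero 1 fun n hn => by rw [coeff_mk, if_neg hn]⟩

theorem Oq.x_mul_y {q : ℂ} (hq0 : q ≠ 0) (hq : ‖q‖ < 1) (U : QDOpens q) :
    Oq.x hq U * Oq.y hq U = q⁻¹ • (Oq.y hq U * Oq.x hq U) := by
  have htw : twist U 1 (coord (partX U)) = q • coord (partX U) := by
    ext z
    simp [twist_apply, coord]
  apply Subtype.ext
  ext1 n
  change coeff n (FormalSeries.mk (fun n => if n = 0 then coord (partX U) else 0) *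
      FormalSeries.mk (fun n => if n = 1 then 1 else 0)) =
    q⁻¹ • coeff n (FormalSeries.mk (fun n => if n = 1 then 1 else 0) *
      FormalSeries.mk (fun n => if n = 0 then coord (partX U) else 0) : FormalSeries U)
  rw [FormalSeries.coeff_mul, FormalSeries.coeff_mul]
  by_cases hn : n = 1
  · subst hn
    simp [Finset.Nat.antidiagonal_succ, htw, smul_smul, hq0]
  · rw [Finset.sum_eq_zero, Finset.sum_eq_zero, smul_zero]
    · rintro ⟨i, j⟩ h
      simp at h ⊢
      intro hi
      rw [if_neg (by omega), map_zero]
    · rintro ⟨i, j⟩ h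
      by_cases hi : i = 0 <;> by_cases hj : j = 1 <;> simp_all

/-- The canonical homomorphism `x ↦ x`, `y ↦ y` from the quantum plane to `𝒪_q(U)`. -/
def canonicalHom {q : ℂ} (hq0 : q ≠ 0) (hq : ‖q‖ < 1) (U : QDOpens q) :
    QuantumPlane q →ₐ[ℂ] Oq hq U :=
  representation (Oq.x hq U) (Oq.y hq U) (Oq.x_mul_y hq0 hq U)

end QPlane

end

/-!
Both directions rest on the holomorphic functional calculus of a Banach algebra element on an
arbitrary open set `V ⊆ ℂ`, which is built here from area integrals. For a cutoff function `φ` that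
is `1` near the spectrum of `T` and has compact support in `V`, put
`f(T) = (-2π)⁻¹ ∫ dbar φ(z) f(z) (z - T)⁻¹`. Integration by parts (`integral_dbar_smul_eq_zero`)
shows that the integral of `dbar φ` against a holomorphic function vanishes, so that the integral
above does not depend on `φ`, and that multiplication by the coordinate goes to multiplication by
`T` (`areaCalculus_coord_mul`). That `1 ↦ 1` (`integral_dbar_smul_resolvent`) follows by comparison
with large radial cutoff functions.

Runge's theorem is then a formal consequence (`eq_top_of_coord_mem`). Let `M` be a subalgebra
of `𝒪(V)` that contains the coordinate and the functions `(a - z)⁻¹`, `a ∉ V`. In the Banach algebra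
given by the closure of `M` in `C(K, ℂ)`, the coordinate has its spectrum in `V`; applying the area
calculus to it inside this algebra yields the restriction of any `f ∈ 𝒪(V)`, as one sees by
evaluating at the points of `K`. Hence a closed condition on `f ∈ 𝒪(V)` that defines a subalgebra
need only be checked on the coordinate and on `(a - z)⁻¹`. In this way one obtains the
multiplicativity of the calculus (`areaCalculus_mul`), its uniqueness
(`holomorphicCalculus_unique`) and the commutation rule `Sⁿ g(T) = g(qⁿT) Sⁿ`
(`pow_mul_calculus_eq`).

If the spectra lie in `U`, the spectral radius formula gives `‖Sⁿ‖ ≤ C ρⁿ` for some `ρ ∈ U_y`,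
so `∑ fₙ(T) Sⁿ` converges absolutely and is bounded by a multiple of `p_{K,ρ}(f)`; the commutation
rule makes it multiplicative (`exists_extension`). Any extension has this form
(`hasSum_extension`), since its restriction to `𝒪(U_x)` is the functional calculus and `f` is the
sum of its terms `fₙ(x) yⁿ` in `𝒪_q(U)`. Conversely, `a - x` for `a ∉ U_x` and `a - y` for
`a ∉ U_y` are invertible already in `𝒪_q(U)`, which gives the spectral inclusions.
-/

noncomputable section

namespace QPlane

open MeasureTheory Set Filter

/-! ### Area integrals against `∂̄` of a cutoff function -/

section AreaIntegral

variable {E : Type*} [NormedAddCommGroup E] [NormedSpace ℂ E]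

/-- The Cauchy-Riemann derivative `∂φ/∂x + i ∂φ/∂y` of a real function on `ℂ`; this is twice the
usual `∂φ/∂z̄`. -/
def dbar (φ : ℂ → ℝ) (z : ℂ) : ℂ := (fderiv ℝ φ z 1 : ℂ) + Complex.I * (fderiv ℝ φ z Complex.I : ℂ)

theorem continuous_dbar {φ : ℂ → ℝ} (hφ : ContDiff ℝ 1 φ) : Continuous (dbar φ) := by
  have h : ∀ v : ℂ, Continuous fun z => fderiv ℝ φ z v := fun v =>
    (hφ.continuous_fderiv one_ne_zero).clm_apply continuous_const
  exact (Complex.continuous_ofReal.comp (h 1)).add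
    (continuous_const.mul (Complex.continuous_ofReal.comp (h Complex.I)))

theorem dbar_eq_zero_of_eventuallyEq_const {φ : ℂ → ℝ} {z : ℂ} {c : ℝ}
    (h : φ =ᶠ[𝓝 z] fun _ => c) : dbar φ z = 0 := by
  simp [dbar, h.fderiv_eq]

theorem tsupport_dbar_subset (φ : ℂ → ℝ) : tsupport (dbar φ) ⊆ tsupport φ := by
  refine closure_minimal (fun z hz => ?_) (isClosed_tsupport φ)
  by_contra h
  exact hz (dbar_eq_zero_of_eventuallyEq_const (c := 0) (notMem_tsupport_iff_eventuallyEq.1 h))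

theorem dbar_sub {φ ψ : ℂ → ℝ} (hφ : ContDiff ℝ 1 φ) (hψ : ContDiff ℝ 1 ψ) (z : ℂ) :
    dbar (φ - ψ) z = dbar φ z - dbar ψ z := by
  simp only [dbar, fderiv_sub (hφ.differentiable one_ne_zero z)
    (hψ.differentiable one_ne_zero z), sub_apply]
  push_cast
  ring

/-- The product of a compactly supported continuous function with a function that is continuous
near the support is integrable. -/
theorem integrable_smul_of_tsupport_subset {𝕜 F : Type*} [RCLike 𝕜] [NormedAddCommGroup F]
    [NormedSpace 𝕜 F] {u : ℂ → 𝕜} {G : ℂ → F} {W : Set ℂ}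
    (hu : Continuous u) (hc : HasCompactSupport u) (hW : IsOpen W) (hs : tsupport u ⊆ W)
    (hG : ContinuousOn G W) : Integrable fun z => u z • G z := by
  have hs' : tsupport (fun z => u z • G z) ⊆ W :=
    (closure_mono (Function.support_smul_subset_left u G)).trans hs
  have h1 : Continuous fun z => u z • G z :=
    (hu.continuousOn.smul hG).continuous_of_tsupport_subset hW hs'
  exact h1.integrable_of_hasCompactSupport hc.smul_right

/-- Stokes' theorem in the form used here: integration by parts moves `∂̄` to the holomorphic
factor, where it vanishes. -/
theorem integral_dbar_smul_eq_zero {φ : ℂ → ℝ} {G : ℂ → E} {W : Set ℂ} [CompleteSpace E]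
    (hφ : ContDiff ℝ 1 φ) (hc : HasCompactSupport φ) (hW : IsOpen W) (hs : tsupport φ ⊆ W)
    (hG : DifferentiableOn ℂ G W) : ∫ z, dbar φ z • G z = 0 := by
  have hder : ∀ z ∈ W, HasDerivAt G (deriv G z) z := fun z hz =>
    (hG.differentiableAt (hW.mem_nhds hz)).hasDerivAt
  have hG'c : ContinuousOn (deriv G) W := (hG.deriv hW).continuousOn
  have key : ∀ v : ℂ, Integrable (fun z => fderiv ℝ φ z v • G z) ∧
      Integrable (fun z => φ z • v • deriv G z) ∧
      ∫ z, φ z • v • deriv G z = - ∫ z, fderiv ℝ φ z v • G z := by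
    intro v
    have hφ' : Continuous fun z => fderiv ℝ φ z v :=
      (hφ.continuous_fderiv one_ne_zero).clm_apply continuous_const
    have hts : tsupport (fun z => fderiv ℝ φ z v) ⊆ tsupport φ := tsupport_fderiv_apply_subset ℝ v
    have i1 : Integrable (fun z => fderiv ℝ φ z v • G z) :=
      integrable_smul_of_tsupport_subset hφ' (hc.fderiv_apply ℝ v) hW (hts.trans hs) hG.continuousOn
    have i2 : Integrable (fun z => φ z • v • deriv G z) :=
      integrable_smul_of_tsupport_subset hφ.continuous hc hW hs (hG'c.const_smul v)
    have i3 : Integrable (fun z => φ z • G z) :=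
      integrable_smul_of_tsupport_subset hφ.continuous hc hW hs hG.continuousOn
    refine ⟨i1, i2, ?_⟩
    refine integral_bilinear_hasLineDerivAt_right_eq_neg_left_of_integrable (v := v)
      (B := ContinuousLinearMap.lsmul ℝ ℝ) (f' := fun z => fderiv ℝ φ z v) i1 i2 i3
      (fun z _ => ?_) (fun z hz => ?_)
    · exact (hφ.differentiable one_ne_zero z).hasFDerivAt.hasLineDerivAt v
    · have := ((hder z (hs hz)).hasFDerivAt.restrictScalars ℝ).hasLineDerivAt v
      simpa using this
  obtain ⟨a1, a2, a3⟩ := key 1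
  obtain ⟨b1, b2, b3⟩ := key Complex.I
  have e1 : ∫ z, dbar φ z • G z =
      (∫ z, fderiv ℝ φ z 1 • G z) + Complex.I • ∫ z, fderiv ℝ φ z Complex.I • G z := by
    have b1' : Integrable fun z => Complex.I • fderiv ℝ φ z Complex.I • G z := b1.smul Complex.I
    rw [← integral_smul, ← integral_add a1 b1']
    refine integral_congr_ae (Eventually.of_forall fun z => ?_)
    simp only [dbar, add_smul, mul_smul, Complex.coe_smul]
  have e2 : (∫ z, φ z • Complex.I • deriv G z) = Complex.I • ∫ z, φ z • (1 : ℂ) • deriv G z := by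
    rw [← integral_smul]
    refine integral_congr_ae (Eventually.of_forall fun z => ?_)
    simp only [one_smul]
    rw [smul_comm]
  have h1 : (∫ z, fderiv ℝ φ z 1 • G z) = - ∫ z, φ z • (1 : ℂ) • deriv G z := by rw [a3, neg_neg]
  have h2 : (∫ z, fderiv ℝ φ z Complex.I • G z) =
      - (Complex.I • ∫ z, φ z • (1 : ℂ) • deriv G z) := by rw [← e2, b3, neg_neg]
  rw [e1, h1, h2, smul_neg, smul_smul, Complex.I_mul_I, neg_smul, one_smul, neg_neg,
    neg_add_cancel]

/-- `φ` is a cutoff function for `K` in `V`: it is `1` near `K` and has compact support in `V`. -/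
structure IsCutoff (φ : ℂ → ℝ) (K V : Set ℂ) : Prop where
  contDiff : ContDiff ℝ 1 φ
  hasCompactSupport : HasCompactSupport φ
  tsupport_subset : tsupport φ ⊆ V
  eq_one : ∀ᶠ z in 𝓝ˢ K, φ z = 1

theorem IsCutoff.mono {φ : ℂ → ℝ} {K K' V V' : Set ℂ} (h : IsCutoff φ K V) (hK : K' ⊆ K)
    (hV : V ⊆ V') : IsCutoff φ K' V' :=
  ⟨h.contDiff, h.hasCompactSupport, h.tsupport_subset.trans hV, h.eq_one.filter_mono
    (nhdsSet_mono hK)⟩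

open scoped Manifold in
theorem exists_isCutoff {K V : Set ℂ} (hK : IsCompact K) (hV : IsOpen V) (hKV : K ⊆ V) :
    ∃ φ : ℂ → ℝ, IsCutoff φ K V := by
  obtain ⟨L, hL, hKL, hLV⟩ := exists_compact_between hK hV hKV
  obtain ⟨f, hf1, hf0, -⟩ := exists_contMDiffMap_one_nhds_of_subset_interior (n := (1 : ℕ∞))
    (𝓘(ℝ, ℂ)) hK.isClosed hKL
  have hs : tsupport f ⊆ L := closure_minimal (fun z hz => by
    by_contra h
    exact hz (hf0 z h)) hL.isClosed
  exact ⟨f, f.contMDiff.contDiff, hL.of_isClosed_subset (isClosed_tsupport f) hs,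
    hs.trans hLV, hf1⟩

theorem IsCutoff.tsupport_dbar_subset {φ : ℂ → ℝ} {K V : Set ℂ} (h : IsCutoff φ K V) :
    tsupport (dbar φ) ⊆ V \ K := by
  intro z hz
  refine ⟨h.tsupport_subset (QPlane.tsupport_dbar_subset φ hz), fun hzK => ?_⟩
  have h1 : ∀ᶠ w in 𝓝 z, φ w = 1 := h.eq_one.filter_mono (nhds_le_nhdsSet hzK)
  have h2 : dbar φ =ᶠ[𝓝 z] 0 := h1.eventually_nhds.mono fun w hw =>
    dbar_eq_zero_of_eventuallyEq_const (c := 1) hw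
  exact notMem_tsupport_iff_eventuallyEq.2 h2 hz

theorem IsCutoff.hasCompactSupport_dbar {φ : ℂ → ℝ} {K V : Set ℂ} (h : IsCutoff φ K V) :
    HasCompactSupport (dbar φ) :=
  h.hasCompactSupport.of_isClosed_subset (isClosed_tsupport _) (QPlane.tsupport_dbar_subset φ)

theorem IsCutoff.integrable {φ : ℂ → ℝ} {K V : Set ℂ} (h : IsCutoff φ K V) (hV : IsOpen V)
    (hK : IsClosed K) {G : ℂ → E} (hG : ContinuousOn G (V \ K)) :
    Integrable fun z => dbar φ z • G z :=
  integrable_smul_of_tsupport_subset (continuous_dbar h.contDiff) h.hasCompactSupport_dbar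
    (hV.sdiff hK) h.tsupport_dbar_subset hG

/-- The area integral of a function holomorphic on `V \ K` does not depend on the cutoff
function. -/
theorem IsCutoff.integral_eq [CompleteSpace E] {φ ψ : ℂ → ℝ} {K V : Set ℂ} (hφ : IsCutoff φ K V)
    (hψ : IsCutoff ψ K V) (hV : IsOpen V) (hK : IsClosed K) {G : ℂ → E}
    (hG : DifferentiableOn ℂ G (V \ K)) :
    ∫ z, dbar φ z • G z = ∫ z, dbar ψ z • G z := by
  have hs : tsupport (φ - ψ) ⊆ V \ K := by
    intro z hz
    refine ⟨?_, fun hzK => ?_⟩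
    · rcases tsupport_sub φ ψ hz with h | h
      · exact hφ.tsupport_subset h
      · exact hψ.tsupport_subset h
    · refine notMem_tsupport_iff_eventuallyEq.2 ?_ hz
      filter_upwards [hφ.eq_one.filter_mono (nhds_le_nhdsSet hzK),
        hψ.eq_one.filter_mono (nhds_le_nhdsSet hzK)] with w h1 h2
      simp [h1, h2]
  have h0 := integral_dbar_smul_eq_zero (hφ.contDiff.sub hψ.contDiff)
    (hφ.hasCompactSupport.sub hψ.hasCompactSupport) (hV.sdiff hK) hs hG
  have h1 : ∀ z, dbar (fun x => φ x - ψ x) z • G z = dbar φ z • G z - dbar ψ z • G z := fun z => by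
    rw [← sub_smul]
    exact congrArg (· • G z) (dbar_sub hφ.contDiff hψ.contDiff z)
  simp only [h1] at h0
  rw [integral_sub (hφ.integrable hV hK hG.continuousOn)
    (hψ.integrable hV hK hG.continuousOn)] at h0
  exact sub_eq_zero.1 h0

end AreaIntegral

/-! ### Radial cutoff functions -/

/-- A radial cutoff function, `1` on `|z|² ≤ R` and `0` on `|z|² ≥ R + 1`. -/
def radialCutoff (R : ℝ) (z : ℂ) : ℝ := Real.smoothTransition (R + 1 - ‖z‖ ^ 2)

/-- The quotient `dbar (radialCutoff R) z / z`, as a function of `|z|`. -/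
def radialWeight (R r : ℝ) : ℝ := -2 * deriv Real.smoothTransition (R + 1 - r ^ 2)

theorem differentiable_smoothTransition : Differentiable ℝ Real.smoothTransition :=
  (Real.smoothTransition.contDiff (n := 1)).differentiable (by simp)

theorem contDiff_radialCutoff (R : ℝ) : ContDiff ℝ 1 (radialCutoff R) :=
  (Real.smoothTransition.contDiff (n := 1)).comp (contDiff_const.sub (contDiff_norm_sq ℝ))

theorem dbar_radialCutoff (R : ℝ) (z : ℂ) :
    dbar (radialCutoff R) z = (radialWeight R ‖z‖ : ℂ) * z := by
  have h := (differentiable_smoothTransition (R + 1 - ‖z‖ ^ 2)).hasDerivAt.comp_hasFDerivAt z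
    ((hasStrictFDerivAt_norm_sq z).hasFDerivAt.const_sub (R + 1))
  have h' : fderiv ℝ (radialCutoff R) z = _ := h.fderiv
  rw [dbar, h']
  apply Complex.ext <;> simp [radialWeight, Complex.inner] <;> ring

theorem isCutoff_radialCutoff {R : ℝ} {K : Set ℂ} (h : ∀ z ∈ K, ‖z‖ ^ 2 < R) :
    IsCutoff (radialCutoff R) K univ where
  contDiff := contDiff_radialCutoff R
  hasCompactSupport := by
    refine HasCompactSupport.of_support_subset_isCompact
      (isCompact_closedBall (0 : ℂ) (Real.sqrt (R + 1))) fun z hz => ?_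
    rw [mem_closedBall_zero_iff]
    refine Real.le_sqrt_of_sq_le ?_
    by_contra! hlt
    exact hz (Real.smoothTransition.zero_of_nonpos (by linarith))
  tsupport_subset := subset_univ _
  eq_one := by
    rw [Filter.Eventually, mem_nhdsSet_iff_forall]
    intro z hz
    have : ∀ᶠ w : ℂ in 𝓝 z, ‖w‖ ^ 2 < R :=
      (continuous_norm.pow 2).continuousAt.eventually_lt continuousAt_const (h z hz)
    filter_upwards [this] with w hw
    exact Real.smoothTransition.one_of_one_le (by linarith)

theorem radialWeight_nonpos (R r : ℝ) : radialWeight R r ≤ 0 := by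
  have : 0 ≤ deriv Real.smoothTransition (R + 1 - r ^ 2) :=
    Real.smoothTransition.monotone.deriv_nonneg
  unfold radialWeight
  linarith

theorem radialWeight_eq_zero {R r : ℝ} (h : r ^ 2 < R) : radialWeight R r = 0 := by
  have : Real.smoothTransition =ᶠ[𝓝 (R + 1 - r ^ 2)] fun _ => 1 := by
    filter_upwards [lt_mem_nhds (show (1 : ℝ) < R + 1 - r ^ 2 by linarith)] with t ht
    exact Real.smoothTransition.one_of_one_le ht.le
  simp [radialWeight, this.deriv_eq]

theorem continuous_radialWeight (R : ℝ) : Continuous (radialWeight R) := by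
  have := (Real.smoothTransition.contDiff (n := 1)).continuous_deriv (by simp)
  unfold radialWeight
  fun_prop

theorem integral_radialWeight {R : ℝ} (hR : 0 ≤ R) :
    ∫ z : ℂ, radialWeight R ‖z‖ = -(2 * Real.pi) := by
  rw [integral_fun_norm_addHaar volume (radialWeight R)]
  have h1 : ∀ r ∈ Ici (0 : ℝ),
      HasDerivAt (fun r : ℝ => Real.smoothTransition (R + 1 - r ^ 2)) (r * radialWeight R r) r := by
    intro r _
    have := (differentiable_smoothTransition (R + 1 - r ^ 2)).hasDerivAt.comp r
      (((hasDerivAt_id r).pow 2).const_sub (R + 1))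
    refine this.congr_deriv ?_
    simp [radialWeight]
    ring
  have h2 : Tendsto (fun r : ℝ => Real.smoothTransition (R + 1 - r ^ 2)) atTop (𝓝 0) := by
    refine tendsto_const_nhds.congr' ?_
    filter_upwards [eventually_ge_atTop (R + 1)] with r hr
    exact (Real.smoothTransition.zero_of_nonpos (by nlinarith)).symm
  have h3 := integral_Ioi_of_hasDerivAt_of_nonpos' h1
    (fun r hr => mul_nonpos_of_nonneg_of_nonpos (le_of_lt hr) (radialWeight_nonpos R r)) h2
  have h4 : Real.smoothTransition (R + 1 - 0 ^ 2) = 1 :=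
    Real.smoothTransition.one_of_one_le (by linarith)
  rw [h4] at h3
  simp [Complex.finrank_real_complex, h3, measureReal_def]

theorem hasCompactSupport_radialWeight (R : ℝ) :
    HasCompactSupport fun z : ℂ => radialWeight R ‖z‖ := by
  refine HasCompactSupport.of_support_subset_isCompact
    (isCompact_closedBall (0 : ℂ) (Real.sqrt (R + 1))) fun z hz => ?_
  rw [mem_closedBall_zero_iff]
  refine Real.le_sqrt_of_sq_le ?_
  by_contra! hlt
  have : Real.smoothTransition =ᶠ[𝓝 (R + 1 - ‖z‖ ^ 2)] fun _ => 0 := by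
    filter_upwards [gt_mem_nhds (show R + 1 - ‖z‖ ^ 2 < 0 by linarith)] with t ht
    exact Real.smoothTransition.zero_of_nonpos ht.le
  exact hz (by simp [radialWeight, this.deriv_eq])

/-! ### The holomorphic functional calculus as an area integral -/

section Calculus

variable {B : Type*} [NormedRing B] [NormedAlgebra ℂ B]

theorem smul_resolvent {T : B} {z : ℂ} (hz : z ∉ spectrum ℂ T) :
    z • resolvent T z = 1 + T * resolvent T z := by
  have h : (algebraMap ℂ B z - T) * resolvent T z = 1 :=
    Ring.mul_inverse_cancel _ (spectrum.notMem_iff.1 hz)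
  rw [sub_mul, ← Algebra.smul_def, sub_eq_iff_eq_add] at h
  exact h

variable [CompleteSpace B]

theorem differentiableOn_resolvent (T : B) :
    DifferentiableOn ℂ (resolvent T) (spectrum ℂ T)ᶜ := fun _ hz =>
  (spectrum.hasDerivAt_resolvent_const_left
    (spectrum.notMem_iff.1 hz)).differentiableAt.differentiableWithinAt

/-- The area integral of the resolvent against a radial cutoff function differs from `-2π` by
`T ∫ w(|z|) (z - T)⁻¹`, which is small because the resolvent vanishes at infinity. -/
theorem integral_dbar_smul_resolvent {φ : ℂ → ℝ} {T : B}
    (hφ : IsCutoff φ (spectrum ℂ T) univ) :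
    ∫ z, dbar φ z • resolvent T z = (-(2 * Real.pi) : ℂ) • (1 : B) := by
  have hσ := spectrum.isClosed (𝕜 := ℂ) T
  have hres : DifferentiableOn ℂ (resolvent T) (univ \ spectrum ℂ T) :=
    (differentiableOn_resolvent T).mono fun z hz => hz.2
  refine eq_of_norm_sub_le_zero (le_of_forall_pos_le_add fun ε hε => ?_)
  rw [zero_add]
  have hlim := (spectrum.resolvent_tendsto_cobounded (𝕜 := ℂ) T).norm
  rw [norm_zero] at hlim
  set δ : ℝ := ε / ((‖T‖ + 1) * (2 * Real.pi)) with hδ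
  have hδ0 : 0 < δ := by positivity
  obtain ⟨r, -, hr⟩ := (hasBasis_cobounded_norm (E := ℂ)).eventually_iff.1
    (hlim.eventually (gt_mem_nhds hδ0))
  obtain ⟨r', -, hr'⟩ := (hasBasis_cobounded_norm (E := ℂ)).eventually_iff.1
    (Bornology.isBounded_def.1 (spectrum.isBounded (𝕜 := ℂ) T))
  set s : ℝ := max (max r r') 0
  have hs0 : 0 ≤ s := le_max_right _ _
  have hlarge : ∀ z : ℂ, s ^ 2 + 1 ≤ ‖z‖ ^ 2 → s ≤ ‖z‖ := fun z hz =>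
    (sq_le_sq₀ hs0 (norm_nonneg z)).1 (by linarith)
  have hsmall : ∀ z ∈ spectrum ℂ T, ‖z‖ ^ 2 < s ^ 2 + 1 := fun z hz => by
    by_contra! h
    exact hr' (((le_max_right r r').trans (le_max_left _ _)).trans (hlarge z h)) hz
  have hψ := isCutoff_radialCutoff hsmall
  set w : ℂ → ℝ := fun z => radialWeight (s ^ 2 + 1) ‖z‖ with hw
  have hwc : Continuous w := (continuous_radialWeight _).comp continuous_norm
  have hwsupp : HasCompactSupport w := hasCompactSupport_radialWeight _
  have hwi : Integrable w := hwc.integrable_of_hasCompactSupport hwsupp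
  have hwint : ∫ z, w z = -(2 * Real.pi) := integral_radialWeight (by positivity)
  -- Off the spectrum, `z (z - T)⁻¹ = 1 + T (z - T)⁻¹`; on the spectrum, the weight vanishes.
  have hpt : ∀ z, dbar (radialCutoff (s ^ 2 + 1)) z • resolvent T z =
      w z • (1 : B) + T * (w z • resolvent T z) := by
    intro z
    rw [dbar_radialCutoff, mul_smul]
    by_cases hz : z ∈ spectrum ℂ T
    · simp [hw, radialWeight_eq_zero (hsmall z hz)]
    · rw [smul_resolvent hz, smul_add, mul_smul_comm]
      simp [hw]
  -- The weight lives where `‖z‖ ≥ s`, hence where the resolvent is smaller than `δ`.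
  have hbd : ∀ z, ‖w z • resolvent T z‖ ≤ δ * -w z := by
    intro z
    have h0 : w z ≤ 0 := radialWeight_nonpos _ _
    rw [norm_smul, Real.norm_of_nonpos h0, mul_comm]
    rcases lt_or_ge (‖z‖ ^ 2) (s ^ 2 + 1) with h | h
    · simp [hw, radialWeight_eq_zero h]
    · refine mul_le_mul_of_nonneg_right (hr ?_).le (by linarith)
      exact ((le_max_left r r').trans (le_max_left _ _)).trans (hlarge z h)
  have hwr : Integrable fun z => w z • resolvent T z := by
    have hts : tsupport w ⊆ (spectrum ℂ T)ᶜ := by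
      have hcl : IsClosed {z : ℂ | s ^ 2 + 1 ≤ ‖z‖ ^ 2} :=
        isClosed_le continuous_const (by fun_prop)
      refine (closure_minimal (fun z hz => ?_) hcl).trans fun z hz hz' =>
        (hsmall z hz').not_ge hz
      by_contra h
      exact hz (radialWeight_eq_zero (not_le.1 h))
    exact integrable_smul_of_tsupport_subset hwc hwsupp hσ.isOpen_compl hts
      (differentiableOn_resolvent T).continuousOn
  rw [hφ.integral_eq hψ isOpen_univ hσ hres]
  simp only [hpt]
  rw [integral_add (hwi.smul_const _) (hwr.const_mul T), integral_smul_const, hwint,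
    integral_const_mul_of_integrable hwr]
  have e : (-(2 * Real.pi)) • (1 : B) = (-(2 * Real.pi) : ℂ) • (1 : B) := by
    rw [← Complex.coe_smul]
    push_cast
    rfl
  rw [e, add_sub_cancel_left]
  have hint : ‖∫ z, w z • resolvent T z‖ ≤ δ * (2 * Real.pi) := by
    refine (norm_integral_le_of_norm_le (hwi.neg.const_mul δ)
      (Eventually.of_forall hbd)).trans_eq ?_
    simp only [Pi.neg_apply]
    rw [integral_const_mul, integral_neg, hwint, neg_neg]
  calc ‖T * ∫ z, w z • resolvent T z‖ ≤ ‖T‖ * (δ * (2 * Real.pi)) :=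
        (norm_mul_le _ _).trans (mul_le_mul_of_nonneg_left hint (norm_nonneg T))
    _ ≤ (‖T‖ + 1) * (δ * (2 * Real.pi)) := by gcongr; linarith
    _ = ε := by rw [hδ]; field_simp

section HolExt

variable {V : Set ℂ}

open scoped Classical in
/-- The extension by zero of a function in `𝒪(V)` to the plane. -/
def holExt (f : Hol V) (z : ℂ) : ℂ := if h : z ∈ V then f.1 ⟨z, h⟩ else 0

theorem holExt_of_mem (f : Hol V) {z : ℂ} (h : z ∈ V) : holExt f z = f.1 ⟨z, h⟩ := dif_pos h

theorem differentiableOn_holExt (f : Hol V) : DifferentiableOn ℂ (holExt f) V := by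
  obtain ⟨F, hF, hf⟩ := f.2
  exact hF.congr fun z hz => by rw [holExt_of_mem f hz, hf]

/-- The element of `𝒪(V)` defined by a function that is holomorphic on `V`. -/
def Hol.ofDifferentiableOn (F : ℂ → ℂ) (hF : DifferentiableOn ℂ F V) : Hol V :=
  ⟨⟨fun z => F z, hF.continuousOn.domRestrict⟩, F, hF, fun _ => rfl⟩

/-- The function `(a - z)⁻¹` in `𝒪(V)` for `a ∉ V`, characterized by `a g = 1 + z g`. -/
theorem exists_smul_eq_one_add_coord_mul {a : ℂ} (ha : a ∉ V) :
    ∃ g : Hol V, a • g = 1 + coord V * g := by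
  have hne : ∀ z ∈ V, a - z ≠ 0 := fun z hz h => ha (by rwa [sub_eq_zero.1 h])
  refine ⟨Hol.ofDifferentiableOn (fun z => (a - z)⁻¹)
    ((differentiableOn_const a).sub differentiableOn_id |>.inv hne), ?_⟩
  ext z
  have := mul_inv_cancel₀ (hne z z.2)
  change a * (a - (z : ℂ))⁻¹ = 1 + (z : ℂ) * (a - (z : ℂ))⁻¹
  linear_combination this

/-- Every holomorphic function is `f(k)` plus a multiple of `z - k`. -/
theorem exists_eq_add_coord_mul (hV : IsOpen V) (f : Hol V) (k : V) :
    ∃ g : Hol V, f = f.1 k • 1 + coord V * g + (-(k : ℂ)) • g := by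
  refine ⟨Hol.ofDifferentiableOn (dslope (holExt f) k)
    ((Complex.differentiableOn_dslope (hV.mem_nhds k.2)).2 (differentiableOn_holExt f)), ?_⟩
  ext z
  change f.1 z = f.1 k * 1 + (z : ℂ) * dslope (holExt f) k z + -k * dslope (holExt f) k z
  have := sub_smul_dslope (holExt f) (k : ℂ) z
  rw [smul_eq_mul, holExt_of_mem f z.2, holExt_of_mem f k.2] at this
  linear_combination -this

/-- The element `(-2π)⁻¹ ∫ dbar φ(z) f(z) (z - T)⁻¹` (an area integral), which is `f(T)` if `φ` is
a cutoff function for the spectrum of `T` in the domain of `f`. -/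
def areaCalculus (T : B) (φ : ℂ → ℝ) (f : Hol V) : B :=
  (-(2 * Real.pi) : ℂ)⁻¹ • ∫ z, dbar φ z • holExt f z • resolvent T z

variable {T : B} {φ : ℂ → ℝ}

theorem IsCutoff.integrable_calculus (hφ : IsCutoff φ (spectrum ℂ T) V) (hV : IsOpen V)
    (f : Hol V) : Integrable fun z => dbar φ z • holExt f z • resolvent T z :=
  hφ.integrable hV (spectrum.isClosed T)
    (((differentiableOn_holExt f).mono sdiff_subset).smul
      ((differentiableOn_resolvent T).mono fun _ hz => hz.2)).continuousOn

/-- Two integrands that agree on the domain have the same integral, because `dbar φ` vanishes off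
the domain and near the spectrum. -/
theorem IsCutoff.integral_congr {E : Type*} [NormedAddCommGroup E] [NormedSpace ℂ E]
    {K : Set ℂ} (hφ : IsCutoff φ K V) {F G : ℂ → E}
    (h : ∀ z ∈ V, z ∉ K → F z = G z) : ∫ z, dbar φ z • F z = ∫ z, dbar φ z • G z := by
  refine integral_congr_ae (Eventually.of_forall fun z => ?_)
  by_cases hz : z ∈ tsupport (dbar φ)
  · have := hφ.tsupport_dbar_subset hz
    simp only [h z this.1 this.2]
  · simp only [image_eq_zero_of_notMem_tsupport hz, zero_smul]

theorem areaCalculus_one (hφ : IsCutoff φ (spectrum ℂ T) V) :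
    areaCalculus T φ (1 : Hol V) = 1 := by
  have h : ∫ z, dbar φ z • holExt (1 : Hol V) z • resolvent T z = ∫ z, dbar φ z • resolvent T z :=
    hφ.integral_congr fun z hz _ => by
      rw [holExt_of_mem _ hz]
      exact one_smul ℂ _
  have hne : (-(2 * Real.pi) : ℂ) ≠ 0 := by simp [Real.pi_ne_zero]
  rw [areaCalculus, h, integral_dbar_smul_resolvent (hφ.mono le_rfl (subset_univ V)), smul_smul,
    inv_mul_cancel₀ hne, one_smul]

theorem areaCalculus_add (hφ : IsCutoff φ (spectrum ℂ T) V) (hV : IsOpen V) (f g : Hol V) :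
    areaCalculus T φ (f + g) = areaCalculus T φ f + areaCalculus T φ g := by
  rw [areaCalculus, areaCalculus, areaCalculus, ← smul_add,
    ← integral_add (hφ.integrable_calculus hV f) (hφ.integrable_calculus hV g)]
  congr 1
  refine integral_congr_ae (Eventually.of_forall fun z => ?_)
  simp only
  rw [← smul_add, ← add_smul]
  congr 2
  by_cases hz : z ∈ V <;> simp [holExt, hz]

theorem areaCalculus_smul {B : Type*} [NormedRing B] [NormedAlgebra ℂ B] {T : B} (c : ℂ)
    (f : Hol V) :
    areaCalculus T φ (c • f) = c • areaCalculus T φ f := by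
  rw [areaCalculus, areaCalculus, smul_comm c, ← integral_smul c]
  congr 1
  refine integral_congr_ae (Eventually.of_forall fun z => ?_)
  simp only
  rw [smul_comm c, smul_smul c]
  congr 2
  by_cases hz : z ∈ V <;> simp [holExt, hz]

/-- Since `z (z - T)⁻¹ = 1 + T (z - T)⁻¹` and the integral of `dbar φ(z) f(z)` is zero, the
functional calculus turns multiplication by the coordinate into multiplication by `T`. -/
theorem areaCalculus_coord_mul (hφ : IsCutoff φ (spectrum ℂ T) V) (hV : IsOpen V) (f : Hol V) :
    areaCalculus T φ (coord V * f) = T * areaCalculus T φ f := by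
  have h1 : ∫ z, dbar φ z • holExt (coord V * f) z • resolvent T z =
      ∫ z, dbar φ z • (holExt f z • (1 : B) + T * (holExt f z • resolvent T z)) :=
    hφ.integral_congr fun z hz hzσ => by
      have : holExt (coord V * f) z = holExt f z * z := by
        rw [holExt_of_mem _ hz, holExt_of_mem _ hz, mul_comm]
        rfl
      rw [this, mul_smul, smul_resolvent hzσ, smul_add, mul_smul_comm]
  have hd : DifferentiableOn ℂ (fun z => holExt f z • (1 : B)) V :=
    (differentiableOn_holExt f).smul_const 1
  have h2 : ∫ z, dbar φ z • holExt f z • (1 : B) = 0 :=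
    integral_dbar_smul_eq_zero hφ.contDiff hφ.hasCompactSupport hV hφ.tsupport_subset hd
  have hi2 : Integrable fun z => dbar φ z • holExt f z • (1 : B) :=
    integrable_smul_of_tsupport_subset (continuous_dbar hφ.contDiff) hφ.hasCompactSupport_dbar hV
      (hφ.tsupport_dbar_subset.trans sdiff_subset) hd.continuousOn
  have hi3 := hφ.integrable_calculus hV f
  rw [areaCalculus, areaCalculus, h1]
  simp only [smul_add, ← mul_smul_comm]
  rw [integral_add hi2 (hi3.const_mul T), h2, zero_add, integral_const_mul_of_integrable hi3,
    mul_smul_comm]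

/-- The functional calculus is bounded by the supremum over the support of the cutoff function. -/
theorem exists_norm_areaCalculus_le (hφ : IsCutoff φ (spectrum ℂ T) V) (hV : IsOpen V) :
    ∃ (K : Compacts V) (C : ℝ), 0 ≤ C ∧ ∀ f : Hol V, ‖areaCalculus T φ f‖ ≤ C * normOn K f := by
  have hK : IsCompact (Subtype.val ⁻¹' tsupport φ : Set V) :=
    Topology.IsInducing.subtypeVal.isCompact_preimage_iff
      (by simpa using hφ.tsupport_subset) |>.2 hφ.hasCompactSupport
  have hi : Integrable fun z => dbar φ z • resolvent T z :=
    hφ.integrable hV (spectrum.isClosed T)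
      ((differentiableOn_resolvent T).mono fun _ hz => hz.2).continuousOn
  refine ⟨⟨_, hK⟩, ‖(-(2 * Real.pi) : ℂ)⁻¹‖ * ∫ z, ‖dbar φ z • resolvent T z‖, by positivity,
    fun f => ?_⟩
  rw [areaCalculus, norm_smul, mul_assoc]
  refine mul_le_mul_of_nonneg_left ?_ (norm_nonneg _)
  rw [← integral_mul_const]
  refine norm_integral_le_of_norm_le (hi.norm.mul_const _) (Eventually.of_forall fun z => ?_)
  by_cases hz : z ∈ tsupport φ
  · rw [smul_comm, norm_smul, mul_comm]
    refine mul_le_mul_of_nonneg_left ?_ (norm_nonneg _)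
    rw [holExt_of_mem f (hφ.tsupport_subset hz)]
    exact norm_apply_le_normOn _ f hz
  · have : z ∉ tsupport (dbar φ) := fun h => hz (tsupport_dbar_subset φ h)
    simp [image_eq_zero_of_notMem_tsupport this]

/-- Characters of the Banach algebra turn the functional calculus into evaluation: write
`f = f(k) + (z - k) g` with `k` the value of the character at `T`. -/
theorem algHom_areaCalculus (hφ : IsCutoff φ (spectrum ℂ T) V) (hV : IsOpen V) (f : Hol V)
    (χ : B →ₐ[ℂ] ℂ) (k : V) (hk : χ T = k) : χ (areaCalculus T φ f) = f.1 k := by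
  obtain ⟨g, hg⟩ := exists_eq_add_coord_mul hV f k
  conv_lhs => rw [hg]
  rw [areaCalculus_add hφ hV, areaCalculus_add hφ hV, areaCalculus_smul, areaCalculus_smul,
    areaCalculus_coord_mul hφ hV, areaCalculus_one hφ]
  simp [hk]

end HolExt

end Calculus

/-! ### Runge's theorem -/

section Runge

variable {V : Set ℂ}

/-- The restriction homomorphism `𝒪(V) → C(K, ℂ)`. -/
def restrictHom (K : Set V) : Hol V →ₐ[ℂ] C(K, ℂ) :=
  (ContinuousMap.compRightAlgHom ℂ ℂ ⟨Subtype.val, continuous_subtype_val⟩).comp (Hol V).val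

theorem mem_closure_iff_compacts (M : Set (Hol V)) (f : Hol V) :
    f ∈ closure M ↔
      ∀ K : Set V, IsCompact K → ∀ ε > 0, ∃ g ∈ M, ∀ z ∈ K, dist (f.1 z) (g.1 z) < ε := by
  have hb := nhds_basis_uniformity'
    (Metric.uniformity_basis_dist (α := ℂ)).compactConvergenceUniformity (x := (f.1 : C(V, ℂ)))
  rw [closure_subtype, mem_closure_iff_nhds_basis hb]
  constructor
  · intro h K hK ε hε
    obtain ⟨_, ⟨g, hg, rfl⟩, hfg⟩ := h (i := (K, ε)) ⟨hK, hε⟩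
    exact ⟨g, hg, hfg⟩
  · rintro h ⟨K, ε⟩ ⟨hK, hε⟩
    obtain ⟨g, hg, hfg⟩ := h K hK ε hε
    exact ⟨g.1, ⟨g, hg, rfl⟩, hfg⟩

/-- The coordinate has its spectrum in `V`, hence so does its image under a homomorphism. -/
theorem spectrum_coord_subset {A : Type*} [Ring A] [Algebra ℂ A] (θ : Hol V →ₐ[ℂ] A) :
    spectrum ℂ (θ (coord V)) ⊆ V := by
  intro a ha
  by_contra haV
  obtain ⟨g, hg⟩ := exists_smul_eq_one_add_coord_mul haV
  have h : a • θ g = 1 + θ (coord V) * θ g := by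
    rw [← map_smul, hg, map_add, map_one, map_mul]
  refine ha ⟨⟨algebraMap ℂ A a - θ (coord V), θ g, ?_, ?_⟩, rfl⟩
  · rw [sub_mul, ← Algebra.smul_def, h, add_sub_cancel_right]
  · rw [mul_sub, ← Algebra.commutes, ← Algebra.smul_def, h, ← map_mul θ, ← map_mul θ,
      mul_comm, add_sub_cancel_right]

/-- Runge's theorem: a closed subalgebra of `𝒪(V)` that contains the coordinate and the inverses
of `a - z` for all `a ∉ V` is all of `𝒪(V)`. For compact `K ⊆ V` the coordinate has, in the closure
of the restriction of the subalgebra to `K`, its spectrum in `V`; the functional calculus inside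
this Banach algebra produces the restriction of any given holomorphic function. -/
theorem eq_top_of_coord_mem (hV : IsOpen V) (M : Subalgebra ℂ (Hol V)) (hcoord : coord V ∈ M)
    (hinv : ∀ a ∉ V, ∀ g : Hol V, a • g = 1 + coord V * g → g ∈ M)
    (hcl : IsClosed (M : Set (Hol V))) : M = ⊤ := by
  refine top_unique fun f _ => ?_
  rw [← SetLike.mem_coe, ← hcl.closure_eq, mem_closure_iff_compacts]
  intro K hK ε hε
  have : CompactSpace K := isCompact_iff_compactSpace.1 hK
  set A : Subalgebra ℂ C(K, ℂ) := (M.map (restrictHom K)).topologicalClosure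
  have : CompleteSpace A :=
    (Subalgebra.isClosed_topologicalClosure (M.map (restrictHom K))).completeSpace_coe
  have hle : ∀ g ∈ M, restrictHom K g ∈ A := fun g hg =>
    Subalgebra.le_topologicalClosure _ ⟨g, hg, rfl⟩
  let Z : A := ⟨restrictHom K (coord V), hle _ hcoord⟩
  have hσ : spectrum ℂ Z ⊆ V := by
    intro a ha
    by_contra haV
    obtain ⟨g, hg⟩ := exists_smul_eq_one_add_coord_mul haV
    have h1 : (algebraMap ℂ A a - Z) * ⟨restrictHom K g, hle g (hinv a haV g hg)⟩ = 1 := by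
      apply Subtype.ext
      change (algebraMap ℂ _ a - restrictHom K (coord V)) * restrictHom K g = 1
      rw [sub_mul, ← Algebra.smul_def, ← map_smul, ← map_mul, hg, map_add, map_one,
        add_sub_cancel_right]
    exact ha (IsUnit.of_mul_eq_one _ h1)
  obtain ⟨φ, hφ⟩ := exists_isCutoff (spectrum.isCompact Z) hV hσ
  set E : A := areaCalculus Z φ f
  have hE : ∀ k : K, E.1 k = f.1 k := fun k =>
    algHom_areaCalculus hφ hV f ((ContinuousMap.evalAlgHom ℂ ℂ k).comp A.val) k rfl
  have hmem : (E : C(K, ℂ)) ∈ closure (M.map (restrictHom K) : Set C(K, ℂ)) := E.2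
  obtain ⟨_, ⟨g, hg, rfl⟩, hgE⟩ := Metric.mem_closure_iff.1 hmem ε hε
  refine ⟨g, hg, fun z hz => ?_⟩
  rw [← hE ⟨z, hz⟩]
  exact (ContinuousMap.dist_apply_le_dist ⟨z, hz⟩).trans_lt hgE

end Runge

/-! ### The holomorphic functional calculus -/

section HolomorphicCalculus

variable {V : Set ℂ}

instance : ContinuousAdd (Hol V) := (Hol V).toSubsemiring.toAddSubmonoid.continuousAdd

theorem continuousMul_hol (hV : IsOpen V) : ContinuousMul (Hol V) :=
  have := hV.locallyCompactSpace
  (Hol V).toSubsemiring.toSubmonoid.continuousMul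

theorem continuous_normOn (K : Compacts V) : Continuous fun f : Hol V => normOn K f :=
  ((ContinuousMap.continuous_restrict (K : Set V)).comp continuous_subtype_val).norm

theorem add_neg_one_smul_self (f : Hol V) : f + (-1 : ℂ) • f = 0 := by
  ext z
  change f.1 z + -1 * f.1 z = 0
  ring

theorem tendsto_normOn_add_neg_one_smul (K : Compacts V) (f₀ : Hol V) :
    Tendsto (fun f => normOn K (f + (-1 : ℂ) • f₀)) (𝓝 f₀) (𝓝 0) := by
  have h : Continuous fun f => normOn K (f + (-1 : ℂ) • f₀) :=
    (continuous_normOn K).comp (continuous_id.add continuous_const)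
  simpa [add_neg_one_smul_self, normOn_zero] using h.tendsto f₀

theorem continuous_of_norm_le_normOn {E : Type*} [SeminormedAddCommGroup E] [Module ℂ E]
    (L : Hol V →ₗ[ℂ] E) (K : Compacts V) (C : ℝ) (h : ∀ f, ‖L f‖ ≤ C * normOn K f) :
    Continuous L := by
  refine continuous_iff_continuousAt.2 fun f₀ => tendsto_iff_norm_sub_tendsto_zero.2 ?_
  have h1 : ∀ f, ‖L f - L f₀‖ ≤ C * normOn K (f + (-1 : ℂ) • f₀) := fun f => by
    refine le_of_eq_of_le (congrArg norm ?_) (h _)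
    rw [map_add, map_smul, neg_one_smul, sub_eq_add_neg]
  refine squeeze_zero (fun _ => norm_nonneg _) h1 ?_
  simpa using (tendsto_normOn_add_neg_one_smul K f₀).const_mul C

variable {B : Type*} [NormedRing B] [NormedAlgebra ℂ B] [CompleteSpace B]

/-- The area calculus is multiplicative, by Runge's theorem. -/
theorem areaCalculus_mul {T : B} {φ : ℂ → ℝ} (hφ : IsCutoff φ (spectrum ℂ T) V) (hV : IsOpen V)
    (f g : Hol V) : areaCalculus T φ (f * g) = areaCalculus T φ f * areaCalculus T φ g := by
  let L : Hol V →ₗ[ℂ] B :=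
    { toFun := areaCalculus T φ
      map_add' := areaCalculus_add hφ hV
      map_smul' := areaCalculus_smul }
  have hL : Continuous L := by
    obtain ⟨K, C, -, hC⟩ := exists_norm_areaCalculus_le hφ hV
    exact continuous_of_norm_le_normOn L K C hC
  have h1 : L 1 = 1 := areaCalculus_one hφ
  have hcoord : ∀ h, L (coord V * h) = T * L h := areaCalculus_coord_mul hφ hV
  -- The `f` that multiply correctly with every `h` form a closed subalgebra.
  let M : Subalgebra ℂ (Hol V) :=
    { carrier := {f | ∀ h, L (f * h) = L f * L h}
      mul_mem' := fun {a b} ha hb h => by rw [mul_assoc, ha, hb, ha, mul_assoc]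
      add_mem' := fun {a b} ha hb h => by rw [add_mul, map_add, ha, hb, map_add, add_mul]
      algebraMap_mem' := fun c h => by
        rw [← Algebra.smul_def, map_smul, Algebra.algebraMap_eq_smul_one, map_smul, h1,
          smul_mul_assoc, one_mul] }
  have hM : M = ⊤ := by
    refine eq_top_of_coord_mem hV M (fun h => ?_) (fun a ha k hk h => ?_) ?_
    · have := hcoord 1
      rw [mul_one, h1, mul_one] at this
      rw [hcoord, this]
    · have hu : IsUnit (algebraMap ℂ B a - T) :=
        spectrum.notMem_iff.1 fun haσ => ha (hφ.tsupport_subset (subset_tsupport φ (by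
          rw [Function.mem_support, hφ.eq_one.self_of_nhdsSet a haσ]
          exact one_ne_zero)))
      have hk' : ∀ h, (algebraMap ℂ B a - T) * L (k * h) = L h := fun h => by
        rw [sub_mul, ← Algebra.smul_def, ← map_smul, ← hcoord, ← smul_mul_assoc, hk, add_mul,
          one_mul, map_add, mul_assoc, add_sub_cancel_right]
      have hk1 := hk' 1
      rw [mul_one, h1] at hk1
      apply hu.mul_left_cancel
      rw [hk', ← mul_assoc, hk1, one_mul]
    · have hMset : (M : Set (Hol V)) = ⋂ h, {f | L (f * h) = L f * L h} := by
        ext f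
        simp only [mem_iInter]
        exact Iff.rfl
      have := continuousMul_hol hV
      rw [hMset]
      exact isClosed_iInter fun h => isClosed_eq (hL.comp (continuous_id.mul continuous_const))
        (hL.mul continuous_const)
  exact (hM ▸ Algebra.mem_top : f ∈ M) g

/-- The holomorphic functional calculus of an element whose spectrum lies in the open set `V`. -/
theorem exists_holomorphicCalculus (hV : IsOpen V) {T : B} (hT : spectrum ℂ T ⊆ V) :
    ∃ θ : Hol V →A[ℂ] B, θ (coord V) = T ∧
      ∃ (K : Compacts V) (C : ℝ), 0 ≤ C ∧ ∀ f, ‖θ f‖ ≤ C * normOn K f := by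
  obtain ⟨φ, hφ⟩ := exists_isCutoff (spectrum.isCompact T) hV hT
  obtain ⟨K, C, hC0, hC⟩ := exists_norm_areaCalculus_le hφ hV
  let L : Hol V →ₐ[ℂ] B := AlgHom.ofLinearMap
    { toFun := areaCalculus T φ
      map_add' := areaCalculus_add hφ hV
      map_smul' := areaCalculus_smul } (areaCalculus_one hφ) (areaCalculus_mul hφ hV)
  refine ⟨⟨L, continuous_of_norm_le_normOn L.toLinearMap K C hC⟩, ?_, K, C, hC0, hC⟩
  have := areaCalculus_coord_mul hφ hV 1
  rwa [mul_one, areaCalculus_one hφ, mul_one] at this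

/-- A continuous homomorphism on `𝒪(V)` is determined by the image of the coordinate. -/
theorem holomorphicCalculus_unique {B : Type*} [NormedRing B] [NormedAlgebra ℂ B]
    (hV : IsOpen V) {θ₁ θ₂ : Hol V →A[ℂ] B}
    (h : θ₁ (coord V) = θ₂ (coord V)) : θ₁ = θ₂ := by
  have hM : AlgHom.equalizer (θ₁ : Hol V →ₐ[ℂ] B) θ₂ = ⊤ := by
    refine eq_top_of_coord_mem hV _ h (fun a _ g hg => ?_)
      (isClosed_eq θ₁.continuous θ₂.continuous)
    have h1 : θ₁ g * (algebraMap ℂ B a - θ₁ (coord V)) = 1 := by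
      rw [mul_sub, ← Algebra.commutes, ← Algebra.smul_def, ← map_smul, hg, map_add, map_one,
        mul_comm, map_mul, add_sub_cancel_right]
    have h2 : (algebraMap ℂ B a - θ₁ (coord V)) * θ₂ g = 1 := by
      rw [h, sub_mul, ← Algebra.smul_def, ← map_smul, hg, map_add, map_one, map_mul,
        add_sub_cancel_right]
    exact left_inv_eq_right_inv h1 h2
  ext f
  exact (hM ▸ Algebra.mem_top : f ∈ AlgHom.equalizer (θ₁ : Hol V →ₐ[ℂ] B) θ₂)

end HolomorphicCalculus

open FormalSeries

/-! ### The parts of a `(q, d)`-open set -/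

section Parts

variable {q : ℂ} (U : QDOpens q)

theorem isOpen_partX : IsOpen (partX U) := by
  rcases partX_isOpen_q U with h | h
  · rw [h]
    exact isOpen_empty
  · exact h.1

theorem partY_isOpen_disk : IsOpen[diskTopology] (partY U) :=
  (le_sup_right : coinduced inclY diskTopology ≤ qdTopology q) _ U.isOpen'

theorem isOpen_partY : IsOpen (partY U) := by
  refine (le_generateFrom ?_ : (inferInstance : TopologicalSpace ℂ) ≤ diskTopology) _
    (partY_isOpen_disk U)
  rintro _ ⟨r, -, rfl⟩
  exact Metric.isOpen_ball

/-- `U_y` is a disk around the origin (possibly empty or everything). -/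
theorem mem_partY_of_norm_le {z w : ℂ} (hz : z ∈ partY U) (h : ‖w‖ ≤ ‖z‖) : w ∈ partY U := by
  have H := partY_isOpen_disk U
  change GenerateOpen _ _ at H
  generalize partY U = V at H hz ⊢
  induction H with
  | basic s hs =>
    obtain ⟨r, -, rfl⟩ := hs
    rw [mem_ball_zero_iff] at hz ⊢
    exact h.trans_lt hz
  | univ => trivial
  | inter s t _ _ ihs iht => exact ⟨ihs hz.1, iht hz.2⟩
  | sUnion S _ ih =>
    obtain ⟨s, hs, hzs⟩ := hz
    exact ⟨s, hs, ih s hs hzs⟩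

theorem partX_eq_empty (h : (0 : ℂ) ∉ partY U) : partX U = ∅ := by
  by_contra hne
  exact h (isSpiraling_partX U (nonempty_iff_ne_empty.2 hne)).1

end Parts

section Elements

variable {q : ℂ} (hq : ‖q‖ < 1) (U : QDOpens q)

theorem continuous_twist (i : ℕ) : Continuous (twist U i) :=
  ((ContinuousMap.continuous_precomp _).comp continuous_subtype_val).subtype_mk _

theorem twist_one_coord : twist U 1 (coord (partX U)) = q • coord (partX U) := by
  ext z
  simp [twist_apply, coord]

variable {U} in
/-- The monomial `h(x) yⁿ` of `𝒪_q(U)`. -/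
def Oq.monomial (n : ℕ) (h : Hol (partX U)) : Oq hq U :=
  ⟨FormalSeries.mk fun m => if m = n then h else 0,
    HasFiniteSeminorms.of_coeff_eq_zero n fun m hm => by rw [coeff_mk, if_neg hm]⟩

variable {U} in
theorem Oq.coeff_monomial (n m : ℕ) (h : Hol (partX U)) :
    coeff m (Oq.monomial hq n h).1 = if m = n then h else 0 := rfl

theorem Oq.ext {f g : Oq hq U} (h : ∀ n, coeff n f.1 = coeff n g.1) : f = g :=
  Subtype.ext (FormalSeries.ext h)

theorem Oq.coeff_mul (f g : Oq hq U) (n : ℕ) : coeff n (f * g).1 =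
    ∑ p ∈ Finset.HasAntidiagonal.antidiagonal n, coeff p.1 f.1 * twist U p.1 (coeff p.2 g.1) := rfl

variable {U} in
theorem Oq.monomial_mul_monomial (n m : ℕ) (g h : Hol (partX U)) :
    Oq.monomial hq n g * Oq.monomial hq m h = Oq.monomial hq (n + m) (g * twist U n h) := by
  apply Oq.ext
  intro k
  rw [Oq.coeff_mul, Oq.coeff_monomial]
  split_ifs with hk
  · rw [Finset.sum_eq_single (n, m)]
    · simp [Oq.coeff_monomial]
    · rintro ⟨i, j⟩ _ hne
      simp only [Oq.coeff_monomial]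
      split_ifs with h1 h2
      · exact absurd (by rw [h1, h2]) hne
      · rw [map_zero, mul_zero]
      · rw [zero_mul]
      · rw [zero_mul]
    · intro h
      exact absurd (Finset.HasAntidiagonal.mem_antidiagonal.2 hk.symm) h
  · refine Finset.sum_eq_zero fun p hp => ?_
    simp only [Oq.coeff_monomial]
    rw [Finset.HasAntidiagonal.mem_antidiagonal] at hp
    split_ifs with h1 h2
    · exact absurd (by rw [← hp, h1, h2]) hk
    · rw [map_zero, mul_zero]
    · rw [zero_mul]
    · rw [zero_mul]

theorem Oq.y_pow (n : ℕ) : Oq.y hq U ^ n = Oq.monomial hq n 1 := by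
  induction n with
  | zero => exact pow_zero _
  | succ n ih =>
    rw [pow_succ, ih]
    exact (Oq.monomial_mul_monomial hq n 1 1 1).trans (by rw [map_one, one_mul])

/-- The embedding of `𝒪(U_x)` into `𝒪_q(U)`. -/
def Oq.ofHol : Hol (partX U) →ₐ[ℂ] Oq hq U :=
  AlgHom.ofLinearMap
    { toFun := Oq.monomial hq 0
      map_add' := fun g h => Oq.ext hq U fun n => by
        change coeff n (Oq.monomial hq 0 (g + h)).1 =
          coeff n (Oq.monomial hq 0 g).1 + coeff n (Oq.monomial hq 0 h).1
        simp only [Oq.coeff_monomial]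
        split_ifs <;> simp
      map_smul' := fun c h => Oq.ext hq U fun n => by
        change coeff n (Oq.monomial hq 0 (c • h)).1 = c • coeff n (Oq.monomial hq 0 h).1
        simp only [Oq.coeff_monomial]
        split_ifs <;> simp }
    rfl (fun g h => by
      have := Oq.monomial_mul_monomial hq 0 0 g h
      rw [twist_zero] at this
      exact this.symm)

theorem Oq.monomial_eq (n : ℕ) (h : Hol (partX U)) :
    Oq.monomial hq n h = Oq.ofHol hq U h * Oq.y hq U ^ n := by
  rw [Oq.y_pow]
  have := Oq.monomial_mul_monomial hq 0 n h 1
  rw [map_one, mul_one, zero_add] at this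
  exact this.symm

end Elements

/-! ### The topology of `𝒪_q(U)` -/

section OqTopology

variable {q : ℂ} {hq : ‖q‖ < 1} {U : QDOpens q}

theorem seminorm_apply (K : Compacts (partX U)) (ρ : {ρ : ℝ // 0 < ρ ∧ (ρ : ℂ) ∈ partY U})
    (f : Oq hq U) : seminorm hq U K ρ f = ∑' n, normOn K (coeff n f.1) * (ρ : ℝ) ^ n := rfl

/-- Convergence in `𝒪_q(U)` is convergence in every seminorm `p_{K,ρ}`. The difference is written
as `u + (-1) f`, so that it can be computed coefficientwise in `𝒪(U_x)` by sums and scalar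
multiples only. -/
theorem tendsto_Oq_iff {α : Type*} {l : Filter α} {u : α → Oq hq U} {f : Oq hq U} :
    Tendsto u l (𝓝 f) ↔
      ∀ K ρ, Tendsto (fun a => seminorm hq U K ρ (u a + (-1 : ℂ) • f)) l (𝓝 0) := by
  rw [nhds_iInf, tendsto_iInf, Prod.forall]
  refine forall_congr' fun K => forall_congr' fun ρ => ?_
  let := (seminorm hq U K ρ).toSeminormedAddCommGroup
  rw [tendsto_iff_norm_sub_tendsto_zero]
  simp only [neg_one_smul, ← sub_eq_add_neg]
  exact Iff.rfl

theorem continuous_of_norm_le_seminorm {E : Type*} [SeminormedAddCommGroup E] [Module ℂ E]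
    (L : Oq hq U →ₗ[ℂ] E) (K : Compacts (partX U))
    (ρ : {ρ : ℝ // 0 < ρ ∧ (ρ : ℂ) ∈ partY U}) (C : ℝ)
    (h : ∀ f, ‖L f‖ ≤ C * seminorm hq U K ρ f) : Continuous L := by
  refine continuous_iff_continuousAt.2 fun f₀ => tendsto_iff_norm_sub_tendsto_zero.2 ?_
  have h1 : ∀ f, ‖L f - L f₀‖ ≤ C * seminorm hq U K ρ (f + (-1 : ℂ) • f₀) := fun f => by
    refine le_of_eq_of_le (congrArg norm ?_) (h _)
    rw [map_add, map_smul, neg_one_smul, sub_eq_add_neg]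
  refine squeeze_zero (fun _ => norm_nonneg _) h1 ?_
  simpa using (tendsto_Oq_iff.1 (tendsto_id (x := 𝓝 f₀)) K ρ).const_mul C

variable (hq U) in
theorem Oq.continuous_ofHol : Continuous (Oq.ofHol hq U) := by
  refine continuous_iff_continuousAt.2 fun h₀ => tendsto_Oq_iff.2 fun K ρ => ?_
  have h1 : ∀ h, seminorm hq U K ρ (Oq.ofHol hq U h + (-1 : ℂ) • Oq.ofHol hq U h₀) =
      normOn K (h + (-1 : ℂ) • h₀) := fun h => by
    rw [← map_smul, ← map_add, seminorm_apply, tsum_eq_single 0]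
    · change normOn K (h + (-1 : ℂ) • h₀) * (ρ : ℝ) ^ 0 = _
      rw [pow_zero, mul_one]
    · intro n hn
      change normOn K (coeff n (Oq.monomial hq 0 (h + (-1 : ℂ) • h₀)).1) * _ = 0
      rw [Oq.coeff_monomial, if_neg hn, normOn_zero, zero_mul]
  simp only [h1]
  exact tendsto_normOn_add_neg_one_smul K h₀

theorem coeff_sum {ι : Type*} (s : Finset ι) (u : ι → Oq hq U) (n : ℕ) :
    coeff n (∑ i ∈ s, u i : Oq hq U).1 = ∑ i ∈ s, coeff n (u i).1 := by
  classical
  induction s using Finset.induction_on with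
  | empty => rfl
  | insert a s ha ih =>
    rw [Finset.sum_insert ha, Finset.sum_insert ha, ← ih]
    rfl

/-- Every element of `𝒪_q(U)` is the sum of its monomials in the topology of `𝒪_q(U)`. -/
theorem Oq.hasSum_monomial (f : Oq hq U) :
    HasSum (fun n => Oq.monomial hq n (coeff n f.1)) f := by
  refine tendsto_Oq_iff.2 fun K ρ => ?_
  have h1 : ∀ (s : Finset ℕ), seminorm hq U K ρ
      (∑ n ∈ s, Oq.monomial hq n (coeff n f.1) + (-1 : ℂ) • f) =
      ∑' n : {n // n ∉ s}, normOn K (coeff n f.1) * (ρ : ℝ) ^ (n : ℕ) := fun s => by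
    rw [seminorm_apply]
    refine Eq.trans ?_
      (tsum_subtype {n | n ∉ s} fun n => normOn K (coeff n f.1) * (ρ : ℝ) ^ n).symm
    refine tsum_congr fun n => ?_
    have h2 : coeff n (∑ n ∈ s, Oq.monomial hq n (coeff n f.1) + (-1 : ℂ) • f : Oq hq U).1 =
        (if n ∈ s then coeff n f.1 else 0) + (-1 : ℂ) • coeff n f.1 := by
      change coeff n (∑ n ∈ s, Oq.monomial hq n (coeff n f.1) : Oq hq U).1 +
        (-1 : ℂ) • coeff n f.1 = _
      rw [coeff_sum]
      simp only [Oq.coeff_monomial, Finset.sum_ite_eq]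
    rw [h2]
    by_cases hn : n ∈ s
    · rw [if_pos hn, add_neg_one_smul_self, normOn_zero, zero_mul,
        indicator_of_notMem (by simpa using hn)]
    · rw [if_neg hn, zero_add, normOn_smul, norm_neg, norm_one, one_mul,
        indicator_of_mem (show n ∈ {n | n ∉ s} from hn)]
  simp only [h1]
  exact tendsto_tsum_compl_atTop_zero fun n => normOn K (coeff n f.1) * (ρ : ℝ) ^ n

end OqTopology

/-! ### Necessity of the spectral inclusions -/

section Necessity

variable {q : ℂ} {hq : ‖q‖ < 1} {U : QDOpens q}

theorem representation_x {B : Type*} [Ring B] [Algebra ℂ B] (T S : B) (h : T * S = q⁻¹ • (S * T)) :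
    representation T S h (RingQuot.mkAlgHom ℂ (Rel q) (FreeAlgebra.ι ℂ 0)) = T := by
  simp [representation]

theorem representation_y {B : Type*} [Ring B] [Algebra ℂ B] (T S : B) (h : T * S = q⁻¹ • (S * T)) :
    representation T S h (RingQuot.mkAlgHom ℂ (Rel q) (FreeAlgebra.ι ℂ 1)) = S := by
  simp [representation]

/-- An extension of the representation is the same as a homomorphism with `x ↦ T`, `y ↦ S`. -/
theorem extends_representation_iff (hq0 : q ≠ 0) {B : Type*} [Ring B] [Algebra ℂ B] {T S : B}
    (h : T * S = q⁻¹ • (S * T)) (Φ : Oq hq U →ₐ[ℂ] B) :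
    (∀ a, Φ (canonicalHom hq0 hq U a) = representation T S h a) ↔
      Φ (Oq.x hq U) = T ∧ Φ (Oq.y hq U) = S := by
  constructor
  · intro H
    have hx := H (RingQuot.mkAlgHom ℂ (Rel q) (FreeAlgebra.ι ℂ 0))
    have hy := H (RingQuot.mkAlgHom ℂ (Rel q) (FreeAlgebra.ι ℂ 1))
    rw [canonicalHom, representation_x, representation_x] at hx
    rw [canonicalHom, representation_y, representation_y] at hy
    exact ⟨hx, hy⟩
  · rintro ⟨hx, hy⟩ a
    have : Φ.comp (canonicalHom hq0 hq U) = representation T S h := by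
      apply RingQuot.ringQuot_ext'
      apply FreeAlgebra.hom_ext
      funext i
      fin_cases i
      · exact (congrArg Φ (representation_x _ _ _)).trans (hx.trans (representation_x T S h).symm)
      · exact (congrArg Φ (representation_y _ _ _)).trans (hy.trans (representation_y T S h).symm)
    exact DFunLike.congr_fun this a

/-- For `a ∉ U_y`, the inverse of `a - y` in `𝒪_q(U)` is the geometric series
`∑ a⁻⁽ⁿ⁺¹⁾ yⁿ`. -/
theorem isUnit_algebraMap_sub_y {a : ℂ} (ha : a ∉ partY U) :
    IsUnit (algebraMap ℂ (Oq hq U) a - Oq.y hq U) := by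
  rcases eq_or_ne a 0 with rfl | ha0
  -- The geometric series needs `a ≠ 0`; if `0 ∉ U_y`, then `U` is empty and `𝒪_q(U)` is trivial.
  · have hX := partX_eq_empty U ha
    have : IsEmpty (partX U) := isEmpty_coe_sort.2 hX
    have : Subsingleton (Oq hq U) := ⟨fun f g => Oq.ext hq U fun n => by
      ext z
      exact isEmptyElim z⟩
    exact isUnit_of_subsingleton _
  have hfin : HasFiniteSeminorms
      (FormalSeries.mk fun n => a⁻¹ ^ (n + 1) • (1 : Hol (partX U))) := by
    intro K ρ hρ hρU
    have hlt : ρ < ‖a‖ := by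
      by_contra! hle
      refine ha (mem_partY_of_norm_le U hρU ?_)
      rwa [Complex.norm_real, Real.norm_of_nonneg hρ.le]
    have hpos : 0 < ‖a‖ := norm_pos_iff.2 ha0
    have hgeo := (summable_geometric_of_lt_one (div_nonneg hρ.le hpos.le)
      ((div_lt_one hpos).2 hlt)).mul_left (‖a‖⁻¹ * normOn K (1 : Hol (partX U)))
    refine hgeo.congr fun n => ?_
    rw [coeff_mk, normOn_smul, norm_pow, norm_inv, pow_succ, div_pow, inv_pow]
    field_simp
  let g : Oq hq U := ⟨_, hfin⟩
  have hg : ∀ n, coeff n g.1 = a⁻¹ ^ (n + 1) • 1 := fun n => rfl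
  have hy : Oq.y hq U = Oq.monomial hq 1 1 := rfl
  have hleft : ∀ n, coeff n (a • g : Oq hq U).1 = coeff n (1 + Oq.y hq U * g : Oq hq U).1 := by
    intro n
    change a • coeff n g.1 = coeff n (1 : FormalSeries U) + coeff n (Oq.y hq U * g).1
    rw [Oq.coeff_mul, hy, coeff_one, hg, smul_smul]
    cases n with
    | zero => simp [Oq.coeff_monomial, ha0]
    | succ n =>
      rw [Finset.sum_eq_single (1, n)]
      · simp only [Oq.coeff_monomial, hg, map_smul, map_one, if_true, one_mul]
        rw [if_neg n.succ_ne_zero, zero_add, pow_succ' _ (n + 1), ← mul_assoc,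
          mul_inv_cancel₀ ha0, one_mul]
      · rintro ⟨i, j⟩ hij hne
        rw [Finset.HasAntidiagonal.mem_antidiagonal] at hij
        have : i ≠ 1 := by
          rintro rfl
          exact hne (by simp at hij ⊢; omega)
        rw [Oq.coeff_monomial, if_neg this, zero_mul]
      · intro h
        exact absurd (Finset.HasAntidiagonal.mem_antidiagonal.2 (by omega)) h
  have hright : ∀ n, coeff n (a • g : Oq hq U).1 = coeff n (1 + g * Oq.y hq U : Oq hq U).1 := by
    intro n
    change a • coeff n g.1 = coeff n (1 : FormalSeries U) + coeff n (g * Oq.y hq U).1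
    rw [Oq.coeff_mul, hy, coeff_one, hg, smul_smul]
    cases n with
    | zero => simp [Oq.coeff_monomial, ha0]
    | succ n =>
      rw [Finset.sum_eq_single (n, 1)]
      · simp only [Oq.coeff_monomial, hg, map_one, if_true, mul_one]
        rw [if_neg n.succ_ne_zero, zero_add, pow_succ' _ (n + 1), ← mul_assoc,
          mul_inv_cancel₀ ha0, one_mul]
      · rintro ⟨i, j⟩ hij hne
        rw [Finset.HasAntidiagonal.mem_antidiagonal] at hij
        have : j ≠ 1 := by
          rintro rfl
          exact hne (by simp at hij ⊢; omega)
        rw [Oq.coeff_monomial, if_neg this, map_zero, mul_zero]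
      · intro h
        exact absurd (Finset.HasAntidiagonal.mem_antidiagonal.2 (by omega)) h
  refine ⟨⟨algebraMap ℂ (Oq hq U) a - Oq.y hq U, g, ?_, ?_⟩, rfl⟩
  · rw [sub_mul, ← Algebra.smul_def, Oq.ext hq U hleft, add_sub_cancel_right]
  · rw [mul_sub, ← Algebra.commutes, ← Algebra.smul_def, Oq.ext hq U hright,
      add_sub_cancel_right]

theorem spectrum_y_subset {A : Type*} [Ring A] [Algebra ℂ A] (Φ : Oq hq U →ₐ[ℂ] A) :
    spectrum ℂ (Φ (Oq.y hq U)) ⊆ partY U :=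
  (AlgHom.spectrum_apply_subset Φ _).trans fun a ha => by
    by_contra h
    exact ha (isUnit_algebraMap_sub_y h)

end Necessity

/-! ### The homomorphism `∑ fₙ(x) yⁿ ↦ ∑ fₙ(T) Sⁿ` -/

section Sufficiency

variable {q : ℂ} {U : QDOpens q} {B : Type*} [NormedRing B] [NormedAlgebra ℂ B]

/-- The commutation rule `S g(T) = g(qT) S`; by Runge's theorem it is enough to check it for the
coordinate and for the inverses of `a - z`. -/
theorem mul_calculus_eq (hq0 : q ≠ 0) {T S : B} (hTS : T * S = q⁻¹ • (S * T))
    (θ : Hol (partX U) →A[ℂ] B) (hθ : θ (coord (partX U)) = T) (g : Hol (partX U)) :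
    S * θ g = θ (twist U 1 g) * S := by
  have hST : S * T = q • (T * S) := by rw [hTS, smul_smul, mul_inv_cancel₀ hq0, one_smul]
  let M : Subalgebra ℂ (Hol (partX U)) :=
    { carrier := {g | S * θ g = θ (twist U 1 g) * S}
      mul_mem' := fun {a b} ha hb => by
        change S * θ (a * b) = θ (twist U 1 (a * b)) * S
        rw [map_mul, ← mul_assoc, show S * θ a = _ from ha, mul_assoc, show S * θ b = _ from hb,
          map_mul, map_mul, mul_assoc]
      add_mem' := fun {a b} ha hb => by
        change S * θ (a + b) = θ (twist U 1 (a + b)) * S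
        rw [map_add, mul_add, show S * θ a = _ from ha, show S * θ b = _ from hb, map_add,
          map_add, add_mul]
      algebraMap_mem' := fun c => by
        change S * θ (algebraMap ℂ _ c) = θ (twist U 1 (algebraMap ℂ _ c)) * S
        rw [AlgHom.commutes, AlgHomClass.commutes, Algebra.commutes] }
  have hM : M = ⊤ := by
    refine eq_top_of_coord_mem (isOpen_partX U) M ?_ (fun a _ g hg => ?_) ?_
    · change S * θ (coord _) = θ (twist U 1 (coord _)) * S
      rw [twist_one_coord, map_smul, hθ, hST, smul_mul_assoc]
    · change S * θ g = θ (twist U 1 g) * S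
      have h1 : (algebraMap ℂ B a - T) * θ g = 1 := by
        rw [← hθ, sub_mul, ← Algebra.smul_def, ← map_smul, hg, map_add, map_one, map_mul,
          add_sub_cancel_right]
      have h2 : a • θ (twist U 1 g) = 1 + q • (θ (twist U 1 g) * T) := by
        rw [← map_smul, ← map_smul, hg, map_add, map_one, map_add, map_one, map_mul,
          twist_one_coord, mul_comm, map_mul, map_smul, hθ, mul_smul_comm]
      have h3 : θ (twist U 1 g) * S * (algebraMap ℂ B a - T) = S := by
        rw [mul_assoc, mul_sub, ← Algebra.commutes, ← Algebra.smul_def, hST, mul_sub,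
          mul_smul_comm, ← smul_mul_assoc, h2, mul_smul_comm, ← mul_assoc, add_mul,
          smul_mul_assoc, one_mul, add_sub_cancel_right]
      calc S * θ g = θ (twist U 1 g) * S * (algebraMap ℂ B a - T) * θ g := by rw [h3]
        _ = θ (twist U 1 g) * S := by rw [mul_assoc, h1, mul_one]
    · exact isClosed_eq (continuous_const.mul θ.continuous)
        ((θ.continuous.comp (continuous_twist U 1)).mul continuous_const)
  exact (hM ▸ Algebra.mem_top : g ∈ M)

theorem pow_mul_calculus_eq (hq0 : q ≠ 0) {T S : B} (hTS : T * S = q⁻¹ • (S * T))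
    (θ : Hol (partX U) →A[ℂ] B) (hθ : θ (coord (partX U)) = T) (n : ℕ) (g : Hol (partX U)) :
    S ^ n * θ g = θ (twist U n g) * S ^ n := by
  induction n with
  | zero => rw [pow_zero, one_mul, mul_one, twist_zero]
  | succ n ih =>
    rw [pow_succ', mul_assoc, ih, ← mul_assoc, mul_calculus_eq hq0 hTS θ hθ, twist_twist,
      mul_assoc, add_comm 1 n]

variable [CompleteSpace B]

/-- By the spectral radius formula, if the spectrum of `S` lies in the disk `U_y`, then the powers
of `S` are controlled by those of some positive radius `ρ ∈ U_y`. -/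
theorem exists_norm_pow_le [Nontrivial B] {S : B} (hS : spectrum ℂ S ⊆ partY U) :
    ∃ (ρ : {ρ : ℝ // 0 < ρ ∧ (ρ : ℂ) ∈ partY U}) (C : ℝ), 0 ≤ C ∧
      ∀ n, ‖S ^ n‖ ≤ C * (ρ : ℝ) ^ n := by
  obtain ⟨k, hk, hkr⟩ := spectrum.exists_nnnorm_eq_spectralRadius S
  have hkU : ((‖k‖ : ℝ) : ℂ) ∈ partY U := mem_partY_of_norm_le U (hS hk) (by simp)
  obtain ⟨ρ, hρ, hρU⟩ : ∃ ρ : ℝ, ‖k‖ < ρ ∧ (ρ : ℂ) ∈ partY U := by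
    have h1 : ∀ᶠ r : ℝ in 𝓝 ‖k‖, (r : ℂ) ∈ partY U :=
      Complex.continuous_ofReal.continuousAt ((isOpen_partY U).mem_nhds hkU)
    exact ((eventually_mem_nhdsWithin (s := Ioi ‖k‖)).and (nhdsWithin_le_nhds h1)).exists
  have hρ0 : 0 < ρ := (norm_nonneg k).trans_lt hρ
  have hlim := spectrum.pow_norm_pow_one_div_tendsto_nhds_spectralRadius S
  have hlt : spectralRadius ℂ S < ENNReal.ofReal ρ := by
    have hk' : (‖k‖₊ : ENNReal) = ENNReal.ofReal ‖k‖ := (ofReal_norm k).symm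
    rwa [← hkr, hk', ENNReal.ofReal_lt_ofReal_iff hρ0]
  have hev : ∀ᶠ n : ℕ in atTop, ‖S ^ n‖ ≤ ρ ^ n := by
    filter_upwards [hlim.eventually (gt_mem_nhds hlt), eventually_ne_atTop 0] with n hn hn0
    rw [ENNReal.ofReal_lt_ofReal_iff hρ0, one_div] at hn
    rw [← Real.rpow_inv_natCast_pow (norm_nonneg (S ^ n)) hn0]
    exact pow_le_pow_left₀ (by positivity) hn.le n
  obtain ⟨N, hN⟩ := eventually_atTop.1 hev
  refine ⟨⟨ρ, hρ0, hρU⟩, 1 + ∑ n ∈ Finset.range N, ‖S ^ n‖ / ρ ^ n, by positivity, fun n => ?_⟩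
  have hsum : 0 ≤ ∑ n ∈ Finset.range N, ‖S ^ n‖ / ρ ^ n := by positivity
  rcases lt_or_ge n N with h | h
  · have h1 : ‖S ^ n‖ / ρ ^ n ≤ ∑ n ∈ Finset.range N, ‖S ^ n‖ / ρ ^ n :=
      Finset.single_le_sum (f := fun n => ‖S ^ n‖ / ρ ^ n) (fun _ _ => by positivity)
        (Finset.mem_range.2 h)
    rw [div_le_iff₀ (by positivity)] at h1
    refine h1.trans ?_
    gcongr
    linarith
  · refine (hN n h).trans (le_mul_of_one_le_left (by positivity) (by linarith))

variable {hq : ‖q‖ < 1}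

theorem norm_calculus_mul_pow_le {B : Type*} [NormedRing B] {θ : Hol (partX U) → B} {S : B}
    {K : Compacts (partX U)}
    {ρ : {ρ : ℝ // 0 < ρ ∧ (ρ : ℂ) ∈ partY U}} {C D : ℝ} (hC : 0 ≤ C)
    (hθ : ∀ f, ‖θ f‖ ≤ C * normOn K f) (hS : ∀ n, ‖S ^ n‖ ≤ D * (ρ : ℝ) ^ n) (f : Oq hq U) (n : ℕ) :
    ‖θ (coeff n f.1) * S ^ n‖ ≤ C * D * (normOn K (coeff n f.1) * (ρ : ℝ) ^ n) :=
  calc ‖θ (coeff n f.1) * S ^ n‖ ≤ (C * normOn K (coeff n f.1)) * (D * (ρ : ℝ) ^ n) :=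
        (norm_mul_le _ _).trans (mul_le_mul (hθ _) (hS n) (norm_nonneg _)
          (mul_nonneg hC (normOn_nonneg K _)))
    _ = _ := by ring

/-- If the spectra lie in `U`, then `∑ fₙ(x) yⁿ ↦ ∑ fₙ(T) Sⁿ` converges absolutely. -/
theorem summable_norm_calculus {T S : B} (hT : spectrum ℂ T ⊆ partX U)
    (hS : spectrum ℂ S ⊆ partY U) (θ : Hol (partX U) →A[ℂ] B) (hθ : θ (coord (partX U)) = T)
    (f : Oq hq U) : Summable fun n => ‖θ (coeff n f.1) * S ^ n‖ := by
  rcases subsingleton_or_nontrivial B with _ | _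
  · simp [Subsingleton.elim _ (0 : B)]
  obtain ⟨θ', hθ', K, C, hC, hb⟩ := exists_holomorphicCalculus (isOpen_partX U) hT
  obtain rfl : θ = θ' := holomorphicCalculus_unique (isOpen_partX U) (hθ.trans hθ'.symm)
  obtain ⟨ρ, D, -, hD⟩ := exists_norm_pow_le hS
  exact .of_nonneg_of_le (fun _ => norm_nonneg _) (norm_calculus_mul_pow_le hC hb hD f)
    ((f.2 K ρ ρ.2.1 ρ.2.2).mul_left (C * D))

/-- If the spectra lie in `U`, then `x ↦ T`, `y ↦ S` extends to a continuous homomorphism, namely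
`∑ fₙ(x) yⁿ ↦ ∑ fₙ(T) Sⁿ`. -/
theorem exists_extension (hq0 : q ≠ 0) {T S : B} (hTS : T * S = q⁻¹ • (S * T))
    (hT : spectrum ℂ T ⊆ partX U) (hS : spectrum ℂ S ⊆ partY U) :
    ∃ Φ : Oq hq U →A[ℂ] B, Φ (Oq.x hq U) = T ∧ Φ (Oq.y hq U) = S := by
  obtain ⟨θ, hθ, K, C, hC, hb⟩ := exists_holomorphicCalculus (isOpen_partX U) hT
  have hsum := summable_norm_calculus (hq := hq) hT hS θ hθ
  have hmono : ∀ n h, ∑' m, θ (coeff m (Oq.monomial hq n h).1) * S ^ m = θ h * S ^ n := by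
    intro n h
    rw [tsum_eq_single n fun m hm => by rw [Oq.coeff_monomial, if_neg hm, map_zero, zero_mul],
      Oq.coeff_monomial, if_pos rfl]
  let L : Oq hq U →ₐ[ℂ] B := AlgHom.ofLinearMap
    { toFun := fun f => ∑' n, θ (coeff n f.1) * S ^ n
      map_add' := fun f g => by
        rw [← (hsum f).of_norm.tsum_add (hsum g).of_norm]
        refine tsum_congr fun n => ?_
        rw [← add_mul, ← map_add]
        rfl
      map_smul' := fun c f => by
        rw [RingHom.id_apply, ← (hsum f).of_norm.tsum_const_smul c]
        refine tsum_congr fun n => ?_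
        rw [← smul_mul_assoc, ← map_smul]
        rfl }
    ((hmono 0 1).trans (by rw [map_one, pow_zero, one_mul]))
    (fun f g => by
      refine Eq.trans ?_
        (tsum_mul_tsum_eq_tsum_sum_antidiagonal_of_summable_norm (hsum f) (hsum g)).symm
      refine tsum_congr fun n => ?_
      rw [Oq.coeff_mul, map_sum, Finset.sum_mul]
      refine Finset.sum_congr rfl fun p hp => ?_
      rw [← Finset.HasAntidiagonal.mem_antidiagonal.1 hp, map_mul, pow_add, mul_assoc, mul_assoc,
        ← mul_assoc (S ^ p.1), pow_mul_calculus_eq hq0 hTS θ hθ, mul_assoc])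
  have hL : ∀ f, L f = ∑' n, θ (coeff n f.1) * S ^ n := fun f => rfl
  have hcont : Continuous L := by
    -- If `B` is trivial, then the spectrum of `S` is empty and no `ρ ∈ U_y` need exist.
    rcases subsingleton_or_nontrivial B with _ | _
    · exact continuous_of_const fun _ _ => Subsingleton.elim _ _
    obtain ⟨ρ, D, -, hD⟩ := exists_norm_pow_le hS
    refine continuous_of_norm_le_seminorm L.toLinearMap K ρ (C * D) fun f => ?_
    change ‖∑' n, θ (coeff n f.1) * S ^ n‖ ≤ _
    rw [seminorm_apply, ← tsum_mul_left]
    exact (norm_tsum_le_tsum_norm (hsum f)).trans ((hsum f).tsum_le_tsum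
      (norm_calculus_mul_pow_le hC hb hD f) ((f.2 K ρ ρ.2.1 ρ.2.2).mul_left (C * D)))
  refine ⟨⟨L, hcont⟩, ?_, ?_⟩
  · exact (hmono 0 (coord (partX U))).trans (by rw [hθ, pow_zero, mul_one])
  · exact (hmono 1 1).trans (by rw [map_one, pow_one, one_mul])

/-- A continuous homomorphism on `𝒪_q(U)` is determined by its restriction to `𝒪(U_x)`, which is
the holomorphic functional calculus, and by the image of `y`. -/
theorem hasSum_extension {B : Type*} [NormedRing B] [NormedAlgebra ℂ B] {T S : B}
    (θ : Hol (partX U) →A[ℂ] B) (hθ : θ (coord (partX U)) = T)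
    (Φ : Oq hq U →A[ℂ] B) (hx : Φ (Oq.x hq U) = T) (hy : Φ (Oq.y hq U) = S) (f : Oq hq U) :
    HasSum (fun n => θ (coeff n f.1) * S ^ n) (Φ f) := by
  let θ' : Hol (partX U) →A[ℂ] B :=
    ⟨(Φ : Oq hq U →ₐ[ℂ] B).comp (Oq.ofHol hq U), Φ.continuous.comp (Oq.continuous_ofHol hq U)⟩
  obtain rfl : θ = θ' := holomorphicCalculus_unique (isOpen_partX U) (hθ.trans hx.symm)
  refine ((Oq.hasSum_monomial f).map Φ Φ.continuous).congr_fun fun n => ?_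
  rw [Function.comp_apply, Oq.monomial_eq, map_mul, map_pow, hy]
  rfl

end Sufficiency

end QPlane

end


theorem theorem5p2 {q : ℂ} (hq0 : q ≠ 0) (hq : ‖q‖ < 1)
    {B : Type*} [NormedRing B] [NormedAlgebra ℂ B] [CompleteSpace B]
    (T S : B) (hTS : T * S = q⁻¹ • (S * T)) (U : QPlane.QDOpens q) :
    -- the representation extends to a continuous homomorphism iff the spectra lie in `U`
    ((∃ Φ : QPlane.Oq hq U →A[ℂ] B,
        ∀ a : QPlane.QuantumPlane q,
          Φ (QPlane.canonicalHom hq0 hq U a) = QPlane.representation T S hTS a) ↔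
      spectrum ℂ T ⊆ QPlane.partX U ∧ spectrum ℂ S ⊆ QPlane.partY U) ∧
    -- in this case there is a unique continuous homomorphism `f ↦ f(T)` of `𝒪(U_x)` with `z ↦ T`,
    -- and the extension is `∑ fₙ(x) yⁿ ↦ ∑ fₙ(T) Sⁿ`, an absolutely convergent series
    (spectrum ℂ T ⊆ QPlane.partX U → spectrum ℂ S ⊆ QPlane.partY U →
      (∃! θ : QPlane.Hol (QPlane.partX U) →A[ℂ] B, θ (QPlane.coord (QPlane.partX U)) = T) ∧
      ∀ θ : QPlane.Hol (QPlane.partX U) →A[ℂ] B, θ (QPlane.coord (QPlane.partX U)) = T →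
        ∀ Φ : QPlane.Oq hq U →A[ℂ] B,
          (∀ a : QPlane.QuantumPlane q,
            Φ (QPlane.canonicalHom hq0 hq U a) = QPlane.representation T S hTS a) →
          ∀ f : QPlane.Oq hq U,
            Summable (fun n : ℕ => ‖θ (QPlane.FormalSeries.coeff n f.1) * S ^ n‖) ∧
            HasSum (fun n : ℕ => θ (QPlane.FormalSeries.coeff n f.1) * S ^ n) (Φ f)) := by
  refine ⟨⟨?_, ?_⟩, ?_⟩
  · rintro ⟨Φ, hΦ⟩
    obtain ⟨hx, hy⟩ := (QPlane.extends_representation_iff hq0 hTS Φ.toAlgHom).1 hΦ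
    constructor
    · rw [← hx]
      exact QPlane.spectrum_coord_subset (Φ.toAlgHom.comp (QPlane.Oq.ofHol hq U))
    · rw [← hy]
      exact QPlane.spectrum_y_subset Φ.toAlgHom
  · rintro ⟨hT, hS⟩
    obtain ⟨Φ, hx, hy⟩ := QPlane.exists_extension (hq := hq) hq0 hTS hT hS
    exact ⟨Φ, (QPlane.extends_representation_iff hq0 hTS Φ.toAlgHom).2 ⟨hx, hy⟩⟩
  · intro hT hS
    constructor
    · obtain ⟨θ, hθ, -⟩ := QPlane.exists_holomorphicCalculus (QPlane.isOpen_partX U) hT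
      exact ⟨θ, hθ, fun θ' hθ' => QPlane.holomorphicCalculus_unique (QPlane.isOpen_partX U)
        (hθ'.trans hθ.symm)⟩
    · intro θ hθ Φ hΦ f
      obtain ⟨hx, hy⟩ := (QPlane.extends_representation_iff hq0 hTS Φ.toAlgHom).1 hΦ
      exact ⟨QPlane.summable_norm_calculus hT hS θ hθ f,
        QPlane.hasSum_extension θ hθ Φ hx hy f⟩
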